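/- Consider the following cooperative game with $m$ players, $K$ actions and horizon $T$. An oblivious adversary fixes, before the game, losses $\ell_t : [K] \to [0,1]$ for $t = 1,\dots,T$. In each round $t$ every player $i \in [m]$ chooses an action $A_{i,t} \in [K]$, and then suffers and observes the loss $$\hat\ell_{i,t} = \max\big(\ell_t(A_{i,t}),\ \mathbf 1\{\exists j \ne i:\ A_{j,t} = A_{i,t}\}\big),$$ and observes nothing else (no collision information). The action $A_{i,t}$ is a measurable function of the player's own random seeds $U_{i,1},\dots,U_{i,t}$ and of her own past losses $\hat\ell_{i,1},\dots,\hat\ell_{i,t-1}$, where all the seeds $U_{i,s}$ ($i \in [m]$, $s \in [T]$) are independent and uniform on $[0,1]$ (no shared randomness). An $m$-player strategy is a choice of these functions for all players and rounds; it may depend on $m$, $K$ and $T$, but not on the losses. Its regret is $$R_T = \max_{S \subset [K],\ |S| = m} \mathbb E \sum_{t=1}^T \Big( \sum_{i=1}^m \hat\ell_{i,t} - \sum_{a \in S} \ell_t(a) \Big).$$ **Theorem.** One has $R_T = \tilde O\big(m K^{3/2} T^{1 - \frac{1}{2m}}\big)$ for a suitable $m$-player strategy. That is, there are universal constants $C >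 0$ and $p \in \mathbb N$ such that for all integers $1 \le m \le K$ and $T \ge 1$ there is an $m$-player strategy for which, against every oblivious adversary, $$R_T \le C\, m\, K^{3/2}\, T^{1 - \frac{1}{2m}}\, \big(1 + \log(KT)\big)^p.$$ -/

import Mathlib

open MeasureTheory

namespace MultiBandit

/-- A (private) strategy of one player with `K` actions and horizon `T`, without collision
information. In round `t` the player sees her own random seeds of the rounds `s ≤ t` and her own
suffered losses of the rounds `s < t`, and nothing else. (Her own past actions are functions of
these data.) -/
structure PlayerStrategy (K T : ℕ) where
  act : (t : Fin T) → (Set.Iic t → unitInterval) → (Set.Iio t → ℝ) → Fin K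
  measurable_act : ∀ t : Fin T,
    Measurable fun h : (Set.Iic t → unitInterval) × (Set.Iio t → ℝ) => act t h.1 h.2

/-- The loss suffered, and observed, by player `i` in a round with losses `l`, when the players
choose the action profile `a`: it is `1` if she collides with another player. -/
noncomputable def sufferedLoss {m K : ℕ} (l : Fin K → ℝ) (a : Fin m → Fin K) (i : Fin m) : ℝ :=
  open Classical in max (l (a i)) (if ∃ j, j ≠ i ∧ a j = a i then 1 else 0)

/-- The action of player `i` in round `t`, when the players use the strategies `σ`, the loss
sequence is `ℓ`, and the random seed of player `j` in round `s` is `ω s j`. -/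
noncomputable def play {m K T : ℕ} (σ : Fin m → PlayerStrategy K T) (ℓ : Fin T → Fin K → ℝ)
    (ω : Fin T → Fin m → unitInterval) (t : Fin T) (i : Fin m) : Fin K :=
  (σ i).act t (fun s => ω s.1 i)
    (fun s => sufferedLoss (ℓ s.1) (fun j => play σ ℓ ω s.1 j) i)
termination_by t.val
decreasing_by exact s.2

/-- The expected regret against the set `S` of actions. The seeds `ω t i` are distributed
according to the product of the uniform measures on `[0, 1]`: they are independent over the rounds
and over the players (no shared randomness). -/
noncomputable def regretAgainst {m K T : ℕ} (σ : Fin m → PlayerStrategy K T)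
    (ℓ : Fin T → Fin K → ℝ) (S : Finset (Fin K)) : ℝ :=
  ∫ ω, ∑ t : Fin T, (∑ i : Fin m, sufferedLoss (ℓ t) (play σ ℓ ω t) i - ∑ a ∈ S, ℓ t a)
    ∂(Measure.pi fun _ : Fin T => Measure.pi fun _ : Fin m => (volume : Measure unitInterval))

/-- The pseudo-regret `R_T`: the maximum over all sets of `m` distinct actions (a maximum over a
finite set, which is nonempty as soon as `m ≤ K`). -/
noncomputable def regret {m K T : ℕ} (σ : Fin m → PlayerStrategy K T)
    (ℓ : Fin T → Fin K → ℝ) : ℝ :=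
  ⨆ S : {S : Finset (Fin K) // S.card = m}, regretAgainst σ ℓ S.1

end MultiBandit

/-! The players act on different time scales. With `N` close to `T ^ (1 / m)`, player `i` keeps an
arm during a sub-block of `N ^ (m - 1 - i)` rounds, and restarts a bandit learner after each block
of `N` sub-blocks. A block of a player lies inside one sub-block of every earlier player, so her
learner faces earlier players who stand still.

Later players make way without any communication. An arm occupied by an earlier player gives the
gain `0`, so its estimated gain stays exactly `0` during the block. A learner whose initial weight
is concentrated on a home arm then plays it with probability at most `1 / N + 1 / √N`
(`Learner.dist_le_of_no_gain`). This requires that the occupied arm is not the home arm, hence every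
player renounces the home arms of the players after her. In this way collisions with later players
cost little (`IsLearnerProcess.integral_estWeight_collision_le`).

To compare with a set `S` of `m` arms, the players in order each remove one arm from `S`: their own
arm if it is still there, and otherwise another remaining arm that they may play. The removed arms
exhaust `S` (`sum_comparator`), and what is left for a player contains no arm of an earlier player
(`comparator_ne`). The removed arm depends on the arm that the player herself plays, so small
external regret would not suffice. The learner has small swap regret, by the Blum–Mansour scheme:
one exponential-weights row per arm, and play according to an almost stationary law of the matrix of
the rows (`Learner.sum_estimated_gain_le`).

The swap regret in one block is of order `K √N` sub-blocks, up to a logarithm. Over `N ^ m` rounds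
this costs each player about `K N ^ m / √N`, and the sum over the players is about `m K T ^ (1 - 1 /
(2 m))`. If `T ^ (1 / m) < 4 K ^ 2`, the trivial bound `m T` is good enough. -/

namespace MultiBandit

/-! ### The swap-regret learner with a home arm -/

/-- The parameters of a swap-regret learner over the arms `arms`, which is biased towards the arm
`home`: learning rate, exploration rate, initial weight of the arms other than `home`, and number
of steps of the averaged random walk that approximates a stationary distribution. -/
structure Learner (K : ℕ) where
  home : Fin K
  arms : Finset (Fin K)
  rate : ℝ
  expl : ℝ
  bias : ℝ
  steps : ℕ

namespace Learner

variable {K : ℕ}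

/-- The conditions on the parameters under which the learner is analysed. -/
structure Valid (q : Learner K) : Prop where
  home_mem : q.home ∈ q.arms
  rate_pos : 0 < q.rate
  expl_pos : 0 < q.expl
  expl_le : q.expl ≤ 1 / 2
  bias_pos : 0 < q.bias
  bias_le : q.bias ≤ 1
  steps_pos : 0 < q.steps
  rate_mul_le : q.rate * K ≤ q.expl

/-- Initial weights. -/
noncomputable def prior (q : Learner K) (a : Fin K) : ℝ :=
  if a = q.home then 1 else if a ∈ q.arms then q.bias else 0

/-- Total weight of the row `s` when the estimated gains are `L`. -/
noncomputable def potential (q : Learner K) (L : Fin K → Fin K → ℝ) (s : Fin K) : ℝ :=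
  ∑ b, q.prior b * Real.exp (q.rate * L s b)

/-- The exponential-weights distribution of the row `s`. -/
noncomputable def row (q : Learner K) (L : Fin K → Fin K → ℝ) (s a : Fin K) : ℝ :=
  q.prior a * Real.exp (q.rate * L s a) / q.potential L s

/-- The law after `k` steps of the Markov chain with transitions `row`, started at `home`. -/
noncomputable def occ (q : Learner K) (L : Fin K → Fin K → ℝ) : ℕ → Fin K → ℝ
  | 0 => fun a => if a = q.home then 1 else 0
  | k + 1 => fun a => ∑ s, occ q L k s * q.row L s a

/-- The averaged law of the Markov chain: an almost stationary distribution. -/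
noncomputable def base (q : Learner K) (L : Fin K → Fin K → ℝ) (a : Fin K) : ℝ :=
  (∑ k ∈ Finset.range q.steps, q.occ L k a) / q.steps

/-- The exploration distribution. -/
noncomputable def explore (q : Learner K) (a : Fin K) : ℝ :=
  (∑ b, if (if b ∈ q.arms then b else q.home) = a then (1 : ℝ) else 0) / K

/-- The distribution of the arm that is played. -/
noncomputable def dist (q : Learner K) (L : Fin K → Fin K → ℝ) (a : Fin K) : ℝ :=
  (1 - q.expl) * q.base L a + q.expl * q.explore a

/-- The increment of the estimated gains when arm `A` has been played with gain `g`. -/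
noncomputable def inc (q : Learner K) (L : Fin K → Fin K → ℝ) (A : Fin K) (g : ℝ) :
    Fin K → Fin K → ℝ :=
  fun s b => if b = A then q.base L s * g / q.dist L A else 0

variable {q : Learner K} (L : Fin K → Fin K → ℝ)

theorem prior_nonneg (hq : q.Valid) (a : Fin K) : 0 ≤ q.prior a := by
  have := hq.bias_pos
  unfold prior; split_ifs <;> linarith

theorem bias_le_prior (hq : q.Valid) {a : Fin K} (ha : a ∈ q.arms) : q.bias ≤ q.prior a := by
  have := hq.bias_le
  unfold prior; split_ifs <;> linarith

theorem exp_home_le_potential (hq : q.Valid) (s : Fin K) :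
    Real.exp (q.rate * L s q.home) ≤ q.potential L s := by
  have h := Finset.single_le_sum (f := fun b => q.prior b * Real.exp (q.rate * L s b))
    (fun b _ => mul_nonneg (prior_nonneg hq b) (Real.exp_pos _).le) (Finset.mem_univ q.home)
  simpa [potential, prior] using h

theorem potential_pos (hq : q.Valid) (s : Fin K) : 0 < q.potential L s :=
  (Real.exp_pos _).trans_le (exp_home_le_potential L hq s)

theorem row_nonneg (hq : q.Valid) (s a : Fin K) : 0 ≤ q.row L s a :=
  div_nonneg (mul_nonneg (prior_nonneg hq a) (Real.exp_pos _).le) (potential_pos L hq s).le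

theorem sum_row (hq : q.Valid) (s : Fin K) : ∑ a, q.row L s a = 1 := by
  unfold row
  rw [← Finset.sum_div]
  exact div_self (potential_pos L hq s).ne'

theorem row_eq_zero (hq : q.Valid) {a : Fin K} (ha : a ∉ q.arms) (s : Fin K) :
    q.row L s a = 0 := by
  have h : a ≠ q.home := fun h => ha (h ▸ hq.home_mem)
  simp [row, prior, h, ha]

theorem occ_nonneg (hq : q.Valid) (k : ℕ) (a : Fin K) : 0 ≤ q.occ L k a := by
  induction k generalizing a with
  | zero => unfold occ; split_ifs <;> norm_num
  | succ k ih => exact Finset.sum_nonneg fun s _ => mul_nonneg (ih s) (row_nonneg L hq s a)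

theorem sum_occ (hq : q.Valid) (k : ℕ) : ∑ a, q.occ L k a = 1 := by
  induction k with
  | zero => simp [occ]
  | succ k ih =>
    simp only [occ]
    rw [Finset.sum_comm]
    simp_rw [← Finset.mul_sum, sum_row L hq, mul_one, ih]

theorem occ_le_one (hq : q.Valid) (k : ℕ) (a : Fin K) : q.occ L k a ≤ 1 :=
  (Finset.single_le_sum (fun b _ => occ_nonneg L hq k b) (Finset.mem_univ a)).trans_eq
    (sum_occ L hq k)

theorem occ_eq_zero (hq : q.Valid) {a : Fin K} (ha : a ∉ q.arms) (k : ℕ) : q.occ L k a = 0 := by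
  cases k with
  | zero =>
    have h : a ≠ q.home := fun h => ha (h ▸ hq.home_mem)
    simp [occ, h]
  | succ k => simp [occ, row_eq_zero L hq ha]

theorem base_nonneg (hq : q.Valid) (a : Fin K) : 0 ≤ q.base L a :=
  div_nonneg (Finset.sum_nonneg fun k _ => occ_nonneg L hq k a) (Nat.cast_nonneg _)

theorem sum_base (hq : q.Valid) : ∑ a, q.base L a = 1 := by
  have : (q.steps : ℝ) ≠ 0 := Nat.cast_ne_zero.2 hq.steps_pos.ne'
  unfold base
  rw [← Finset.sum_div, Finset.sum_comm]
  simp [sum_occ L hq, this]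

theorem base_le_one (hq : q.Valid) (a : Fin K) : q.base L a ≤ 1 :=
  (Finset.single_le_sum (fun b _ => base_nonneg L hq b) (Finset.mem_univ a)).trans_eq
    (sum_base L hq)

theorem base_eq_zero (hq : q.Valid) {a : Fin K} (ha : a ∉ q.arms) : q.base L a = 0 := by
  simp [base, occ_eq_zero L hq ha]

/-- `base` is almost stationary. -/
theorem sum_base_mul_row_le (hq : q.Valid) (a : Fin K) :
    ∑ s, q.base L s * q.row L s a ≤ q.base L a + 1 / q.steps := by
  have hn : (0 : ℝ) < q.steps := Nat.cast_pos.2 hq.steps_pos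
  have h1 : ∑ s, q.base L s * q.row L s a =
      (∑ k ∈ Finset.range q.steps, q.occ L (k + 1) a) / q.steps := by
    simp only [base, occ, div_mul_eq_mul_div, Finset.sum_mul]
    rw [← Finset.sum_div, Finset.sum_comm]
  -- One step of the chain shifts the time average by one index, so only the two end terms differ.
  have h2 := Finset.sum_range_succ (fun k => q.occ L k a) q.steps
  have h3 := Finset.sum_range_succ' (fun k => q.occ L k a) q.steps
  rw [h1, base, ← add_div]
  gcongr
  linarith [occ_le_one L hq q.steps a, occ_nonneg L hq 0 a]

theorem explore_nonneg (a : Fin K) : 0 ≤ q.explore a :=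
  div_nonneg (Finset.sum_nonneg fun b _ => by split_ifs <;> norm_num) (Nat.cast_nonneg _)

theorem sum_explore : ∑ a, q.explore a = 1 := by
  have hK : (K : ℝ) ≠ 0 := Nat.cast_ne_zero.2 (Fin.pos q.home).ne'
  unfold explore
  rw [← Finset.sum_div, Finset.sum_comm]
  simp [hK]

theorem explore_eq_zero (hq : q.Valid) {a : Fin K} (ha : a ∉ q.arms) : q.explore a = 0 := by
  have : ∀ b, (if b ∈ q.arms then b else q.home) ≠ a := by
    intro b h
    split_ifs at h with hb
    · exact ha (h ▸ hb)
    · exact ha (h ▸ hq.home_mem)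
  simp [explore, this]

theorem inv_le_explore {a : Fin K} (ha : a ∈ q.arms) : 1 / K ≤ q.explore a := by
  unfold explore
  gcongr
  have h := Finset.single_le_sum
    (f := fun b => if (if b ∈ q.arms then b else q.home) = a then (1 : ℝ) else 0)
    (fun b _ => by split_ifs <;> norm_num) (Finset.mem_univ a)
  simpa [ha] using h

theorem explore_le_inv {a : Fin K} (ha : a ≠ q.home) : q.explore a ≤ 1 / K := by
  unfold explore
  gcongr
  calc _ ≤ ∑ b, (if b = a then (1 : ℝ) else 0) := by
        refine Finset.sum_le_sum fun b _ => ?_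
        by_cases hb : b ∈ q.arms
        · simp [hb]
        · simp only [hb, if_false, ha.symm]; split_ifs <;> norm_num
    _ = 1 := by simp

theorem dist_nonneg (hq : q.Valid) (a : Fin K) : 0 ≤ q.dist L a :=
  add_nonneg (mul_nonneg (by linarith [hq.expl_le]) (base_nonneg L hq a))
    (mul_nonneg hq.expl_pos.le (explore_nonneg a))

theorem sum_dist (hq : q.Valid) : ∑ a, q.dist L a = 1 := by
  simp only [dist]
  rw [Finset.sum_add_distrib, ← Finset.mul_sum, ← Finset.mul_sum, sum_base L hq, sum_explore]
  ring

theorem dist_eq_zero (hq : q.Valid) {a : Fin K} (ha : a ∉ q.arms) : q.dist L a = 0 := by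
  simp [dist, base_eq_zero L hq ha, explore_eq_zero hq ha]

theorem expl_div_le_dist (hq : q.Valid) {a : Fin K} (ha : a ∈ q.arms) :
    q.expl / K ≤ q.dist L a := by
  have h1 := mul_le_mul_of_nonneg_left (inv_le_explore ha) hq.expl_pos.le
  have h2 := mul_nonneg (by linarith [hq.expl_le] : 0 ≤ 1 - q.expl) (base_nonneg L hq a)
  rw [mul_one_div] at h1
  unfold dist; linarith

theorem dist_pos (hq : q.Valid) {a : Fin K} (ha : a ∈ q.arms) : 0 < q.dist L a :=
  (div_pos hq.expl_pos (Nat.cast_pos.2 (Fin.pos a))).trans_le (expl_div_le_dist L hq ha)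

theorem dist_le (hq : q.Valid) (a : Fin K) :
    q.dist L a ≤ q.base L a + q.expl * q.explore a := by
  have := mul_nonneg hq.expl_pos.le (base_nonneg L hq a)
  unfold dist; linarith

/-- An arm without any gain is played rarely, if it is not the home arm. -/
theorem dist_le_of_no_gain (hq : q.Valid) (hL : ∀ s b, 0 ≤ L s b) {a : Fin K}
    (ha : a ≠ q.home) (h0 : ∀ s, L s a = 0) : q.dist L a ≤ q.bias + q.expl / K := by
  have hrow : ∀ s, q.row L s a ≤ q.bias := by
    intro s
    -- The home arm has prior weight `1` and nonnegative estimated gain, so it alone contributes at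
    -- least `1`.
    have h1 : 1 ≤ q.potential L s := (Real.one_le_exp
      (mul_nonneg hq.rate_pos.le (hL s q.home))).trans (exp_home_le_potential L hq s)
    unfold row
    rw [h0, mul_zero, Real.exp_zero, mul_one]
    refine (div_le_self (prior_nonneg hq a) h1).trans ?_
    have := hq.bias_pos
    simp only [prior, ha, if_false]
    split_ifs <;> linarith
  have hocc : ∀ k, q.occ L k a ≤ q.bias := by
    intro k
    cases k with
    | zero => simpa [occ, ha] using hq.bias_pos.le
    | succ k =>
      calc q.occ L (k + 1) a ≤ ∑ s, q.occ L k s * q.bias :=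
            Finset.sum_le_sum fun s _ => mul_le_mul_of_nonneg_left (hrow s) (occ_nonneg L hq k s)
        _ = q.bias := by rw [← Finset.sum_mul, sum_occ L hq, one_mul]
  have hbase : q.base L a ≤ q.bias := by
    unfold base
    rw [div_le_iff₀ (Nat.cast_pos.2 hq.steps_pos)]
    calc _ ≤ ∑ k ∈ Finset.range q.steps, q.bias := Finset.sum_le_sum fun k _ => hocc k
      _ = _ := by simp [mul_comm]
  have h2 := mul_le_mul_of_nonneg_left (explore_le_inv ha) hq.expl_pos.le
  rw [mul_one_div] at h2
  linarith [dist_le L hq a]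

theorem inc_nonneg (hq : q.Valid) (A : Fin K) {g : ℝ} (hg : 0 ≤ g) (s b : Fin K) :
    0 ≤ q.inc L A g s b := by
  unfold inc
  split_ifs
  · exact div_nonneg (mul_nonneg (base_nonneg L hq s) hg) (dist_nonneg L hq A)
  · exact le_rfl

/-- Only the entry `A` of the row changes, so its potential is multiplied by `1 + row * (exp y -
1)`. The exploration floor and `rate * K ≤ expl` keep `y ≤ 1`, where `exp y ≤ 1 + y + y ^ 2`. The
bound is kept linear in `base L s`, so that stationarity applies after summation over `s`. -/
theorem log_potential_add_inc_le (hq : q.Valid) {A : Fin K} (hA : A ∈ q.arms) {g : ℝ}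
    (hg0 : 0 ≤ g) (hg1 : g ≤ 1) (s : Fin K) :
    Real.log (q.potential (L + q.inc L A g) s) - Real.log (q.potential L s) ≤
      q.base L s * q.row L s A * (q.rate * (g / q.dist L A) * (1 + q.rate * (g / q.dist L A))) := by
  have hpos := potential_pos L hq s
  have hd := dist_pos L hq hA
  set x := g / q.dist L A with hx
  have hx0 : 0 ≤ x := div_nonneg hg0 hd.le
  have hK : (0 : ℝ) < K := Nat.cast_pos.2 (Fin.pos A)
  have hrx : q.rate * x ≤ 1 := by
    have h1 : x ≤ K / q.expl := by
      rw [hx, div_le_div_iff₀ hd hq.expl_pos]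
      have := expl_div_le_dist L hq hA
      rw [div_le_iff₀ hK] at this
      nlinarith [hq.expl_pos]
    calc q.rate * x ≤ q.rate * (K / q.expl) := mul_le_mul_of_nonneg_left h1 hq.rate_pos.le
      _ = q.rate * K / q.expl := by ring
      _ ≤ 1 := (div_le_one hq.expl_pos).2 hq.rate_mul_le
  have hb0 := base_nonneg L hq s
  have hb1 := base_le_one L hq s
  set y := q.rate * (q.base L s * x) with hy
  have hy0 : 0 ≤ y := mul_nonneg hq.rate_pos.le (mul_nonneg hb0 hx0)
  have hyx : y ≤ q.base L s * (q.rate * x) := by rw [hy]; linarith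
  have hy1 : y ≤ 1 := by
    have : 0 ≤ q.rate * x := mul_nonneg hq.rate_pos.le hx0
    nlinarith
  have hexp : Real.exp y - 1 ≤ q.base L s * (q.rate * x * (1 + q.rate * x)) := by
    have h := Real.abs_exp_sub_one_sub_id_le (x := y) (by rwa [abs_of_nonneg hy0])
    have h' := (abs_le.1 h).2
    have hr : 0 ≤ q.rate * x := mul_nonneg hq.rate_pos.le hx0
    have : y ^ 2 ≤ q.base L s * (q.rate * x) ^ 2 := by
      have : y ^ 2 = q.base L s * (q.base L s * (q.rate * x) ^ 2) := by rw [hy]; ring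
      rw [this]
      exact mul_le_mul_of_nonneg_left (mul_le_of_le_one_left (sq_nonneg _) hb1) hb0
    nlinarith
  have hpot : q.potential (L + q.inc L A g) s =
      q.potential L s * (1 + q.row L s A * (Real.exp y - 1)) := by
    have h1 : q.potential L s * (q.row L s A * (Real.exp y - 1)) =
        q.prior A * Real.exp (q.rate * L s A) * (Real.exp y - 1) := by
      unfold row; field_simp
    rw [mul_add, mul_one, h1]
    have h2 : ∀ b, q.prior b * Real.exp (q.rate * (L + q.inc L A g) s b) =
        q.prior b * Real.exp (q.rate * L s b) +
          if b = A then q.prior A * Real.exp (q.rate * L s A) * (Real.exp y - 1) else 0 := by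
      intro b
      by_cases hb : b = A
      · subst hb
        have : q.rate * (L + q.inc L b g) s b = q.rate * L s b + y := by
          simp only [Pi.add_apply, inc, if_true, hy, hx]; ring
        rw [this, Real.exp_add]; simp; ring
      · simp [inc, hb]
    unfold potential
    rw [Finset.sum_congr rfl fun b _ => h2 b, Finset.sum_add_distrib]
    simp
  have hz : 0 ≤ q.row L s A * (Real.exp y - 1) :=
    mul_nonneg (row_nonneg L hq s A) (by linarith [Real.one_le_exp hy0])
  rw [hpot, Real.log_mul hpos.ne' (by linarith)]
  have hlog := Real.log_le_sub_one_of_pos (x := 1 + q.row L s A * (Real.exp y - 1)) (by linarith)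
  have := mul_le_mul_of_nonneg_left hexp (row_nonneg L hq s A)
  linarith

/-- Almost stationarity turns the sum of `base * row` over the rows into `base L A + 1 / steps`,
which is nearly `dist L A`. This factor cancels the importance weight `1 / dist L A` to first order,
and leaves the actual gain. -/
theorem sum_log_potential_add_inc_le (hq : q.Valid) {A : Fin K} (hA : A ∈ q.arms) {g : ℝ}
    (hg0 : 0 ≤ g) (hg1 : g ≤ 1) (hsteps : (K : ℝ) / (q.steps * q.expl) ≤ 1) :
    ∑ s, (Real.log (q.potential (L + q.inc L A g) s) - Real.log (q.potential L s)) ≤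
      q.rate * (g + (2 * q.expl + K / (q.steps * q.expl)) + 3 * q.rate * (g / q.dist L A)) := by
  have hd := dist_pos L hq hA
  have hK : (0 : ℝ) < K := Nat.cast_pos.2 (Fin.pos A)
  have hn : (0 : ℝ) < q.steps := Nat.cast_pos.2 hq.steps_pos
  have he := hq.expl_pos
  have hr := hq.rate_pos
  set κ := (K : ℝ) / (q.steps * q.expl) with hκ
  set x := g / q.dist L A with hx
  have hx0 : 0 ≤ x := div_nonneg hg0 hd.le
  have hκ0 : 0 ≤ κ := by positivity
  have hκ1 : 1 / q.steps ≤ κ * q.dist L A := by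
    calc (1 : ℝ) / q.steps = κ * (q.expl / K) := by rw [hκ]; field_simp
      _ ≤ _ := mul_le_mul_of_nonneg_left (expl_div_le_dist L hq hA) hκ0
  -- This uses `(1 - e) * (1 + 2 * e) ≥ 1` for `0 ≤ e ≤ 1 / 2`.
  have hbase : q.base L A ≤ (1 + 2 * q.expl) * q.dist L A := by
    have h1 : (1 - q.expl) * q.base L A ≤ q.dist L A := by
      have := mul_nonneg he.le (explore_nonneg (q := q) A)
      unfold dist; linarith
    have h2 := mul_le_mul_of_nonneg_left h1 (by linarith : 0 ≤ 1 + 2 * q.expl)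
    have h3 : 0 ≤ q.base L A * (q.expl * (1 - 2 * q.expl)) :=
      mul_nonneg (base_nonneg L hq A) (mul_nonneg he.le (by linarith [hq.expl_le]))
    nlinarith
  have hstat : ∑ s, q.base L s * q.row L s A ≤ (1 + 2 * q.expl + κ) * q.dist L A := by
    linarith [sum_base_mul_row_le L hq A]
  have hdx : q.dist L A * x = g := by rw [hx]; field_simp
  have hf : 0 ≤ q.rate * x * (1 + q.rate * x) := by positivity
  calc _ ≤ ∑ s, q.base L s * q.row L s A * (q.rate * x * (1 + q.rate * x)) :=
        Finset.sum_le_sum fun s _ => log_potential_add_inc_le L hq hA hg0 hg1 s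
    _ = (∑ s, q.base L s * q.row L s A) * (q.rate * x * (1 + q.rate * x)) := by
        rw [Finset.sum_mul]
    _ ≤ (1 + 2 * q.expl + κ) * q.dist L A * (q.rate * x * (1 + q.rate * x)) :=
        mul_le_mul_of_nonneg_right hstat hf
    _ = q.rate * ((1 + 2 * q.expl + κ) * (q.dist L A * x) * (1 + q.rate * x)) := by ring
    _ ≤ _ := by
        rw [hdx]
        refine mul_le_mul_of_nonneg_left ?_ hr.le
        have hle := hq.expl_le
        have h1 : (2 * q.expl + κ) * g ≤ 2 * q.expl + κ :=
          mul_le_of_le_one_right (by positivity) hg1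
        have h2 : (1 + 2 * q.expl + κ) * g ≤ 3 := by nlinarith
        have h3 := mul_le_mul_of_nonneg_right h2 (by positivity : 0 ≤ q.rate * x)
        nlinarith

/-- The regret bound of the learner, pathwise and for the importance-weighted gains, against the
swap function `φ`. -/
theorem sum_estimated_gain_le (hq : q.Valid) (hsteps : (K : ℝ) / (q.steps * q.expl) ≤ 1)
    (n : ℕ) (M : ℕ → Fin K → Fin K → ℝ) (A : ℕ → Fin K) (g : ℕ → ℝ) (hA : ∀ k, A k ∈ q.arms)
    (hg0 : ∀ k, 0 ≤ g k) (hg1 : ∀ k, g k ≤ 1) (hM0 : M 0 = 0)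
    (hM : ∀ k, k + 1 < n → M (k + 1) = M k + q.inc (M k) (A k) (g k))
    (φ : Fin K → Fin K) (hφ : ∀ s, φ s ∈ q.arms) :
    ∑ k ∈ Finset.range n, ∑ s, q.inc (M k) (A k) (g k) s (φ s) ≤
      ∑ k ∈ Finset.range n, (g k + (2 * q.expl + K / (q.steps * q.expl)) +
          3 * q.rate * (g k / q.dist (M k) (A k))) +
        K * (Real.log (1 + K * q.bias) - Real.log q.bias) / q.rate := by
  have hr := hq.rate_pos
  have hε := hq.bias_pos
  -- The recursion `hM` stops before index `n`, where the learner is reset; `M'` also contains the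
  -- last increment.
  let M' : ℕ → Fin K → Fin K → ℝ := fun j => ∑ k ∈ Finset.range j, q.inc (M k) (A k) (g k)
  have hM' : ∀ j, j < n → M' j = M j := by
    intro j hj
    induction j with
    | zero => simp [M', hM0]
    | succ j ih =>
      rw [hM j hj, ← ih (by omega)]
      simp only [M']
      rw [Finset.sum_range_succ]
      congr 2
      exact (ih (by omega)).symm
  have hM's : ∀ j, M' (j + 1) = M' j + q.inc (M j) (A j) (g j) := fun j =>
    Finset.sum_range_succ _ _
  have hstep : ∀ j, j < n →
      ∑ s, (Real.log (q.potential (M' (j + 1)) s) - Real.log (q.potential (M' j) s)) ≤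
      q.rate * (g j + (2 * q.expl + K / (q.steps * q.expl)) +
        3 * q.rate * (g j / q.dist (M j) (A j))) := by
    intro j hj
    rw [hM's, hM' j hj]
    exact sum_log_potential_add_inc_le (M j) hq (hA j) (hg0 j) (hg1 j) hsteps
  have htel : ∑ s, (Real.log (q.potential (M' n) s) - Real.log (q.potential (M' 0) s)) ≤
      ∑ j ∈ Finset.range n, q.rate * (g j + (2 * q.expl + K / (q.steps * q.expl)) +
        3 * q.rate * (g j / q.dist (M j) (A j))) := by
    refine le_trans (le_of_eq ?_) (Finset.sum_le_sum fun j hj => hstep j (Finset.mem_range.1 hj))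
    rw [Finset.sum_comm]
    refine Finset.sum_congr rfl fun s _ => ?_
    exact (Finset.sum_range_sub (fun j => Real.log (q.potential (M' j) s)) n).symm
  have hpot0 : ∀ s, Real.log (q.potential (M' 0) s) ≤ Real.log (1 + K * q.bias) := by
    intro s
    refine Real.log_le_log (potential_pos _ hq s) ?_
    calc q.potential (M' 0) s = ∑ b, q.prior b := by simp [potential, M']
      _ ≤ ∑ b, ((if b = q.home then (1 : ℝ) else 0) + q.bias) := by
          refine Finset.sum_le_sum fun b _ => ?_
          unfold prior; split_ifs <;> linarith
      _ = _ := by rw [Finset.sum_add_distrib]; simp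
  have hpotn : ∀ s, Real.log q.bias + q.rate * M' n s (φ s) ≤
      Real.log (q.potential (M' n) s) := by
    intro s
    rw [← Real.log_exp (q.rate * M' n s (φ s)), ← Real.log_mul hε.ne' (Real.exp_pos _).ne']
    refine Real.log_le_log (mul_pos hε (Real.exp_pos _)) ?_
    refine (mul_le_mul_of_nonneg_right (bias_le_prior hq (hφ s)) (Real.exp_pos _).le).trans ?_
    exact Finset.single_le_sum (f := fun b => q.prior b * Real.exp (q.rate * M' n s b))
      (fun b _ => mul_nonneg (prior_nonneg hq b) (Real.exp_pos _).le) (Finset.mem_univ (φ s))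
  have hlow : ∑ s, (q.rate * M' n s (φ s) - (Real.log (1 + K * q.bias) - Real.log q.bias)) ≤
      ∑ s, (Real.log (q.potential (M' n) s) - Real.log (q.potential (M' 0) s)) :=
    Finset.sum_le_sum fun s _ => by linarith [hpot0 s, hpotn s]
  have hsum : ∑ k ∈ Finset.range n, ∑ s, q.inc (M k) (A k) (g k) s (φ s) =
      ∑ s, M' n s (φ s) := by
    rw [Finset.sum_comm]
    refine Finset.sum_congr rfl fun s _ => ?_
    simp [M', Finset.sum_apply]
  rw [Finset.sum_sub_distrib, ← Finset.mul_sum, Finset.sum_const, Finset.card_univ,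
    Fintype.card_fin, nsmul_eq_mul] at hlow
  rw [← Finset.mul_sum] at htel
  rw [hsum, ← sub_le_iff_le_add, ← mul_le_mul_iff_right₀ hr, mul_sub, mul_div_cancel₀ _ hr.ne']
  exact hlow.trans htel

end Learner

end MultiBandit

/-! ### Restarting the learner after every `N` steps -/

namespace MultiBandit

theorem sum_range_mul_eq (a b : ℕ) (f : ℕ → ℝ) :
    ∑ t ∈ Finset.range (a * b), f t =
      ∑ i ∈ Finset.range a, ∑ j ∈ Finset.range b, f (i * b + j) := by
  induction a with
  | zero => simp
  | succ a ih => rw [Nat.succ_mul, Finset.sum_range_add, ih, Finset.sum_range_succ]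

namespace Learner

variable {K : ℕ}

/-- The estimated gains after the arms `A` have been played with the gains `g`; they are reset
every `N` steps. -/
noncomputable def state (q : Learner K) (N : ℕ) (A : ℕ → Fin K) (g : ℕ → ℝ) :
    ℕ → Fin K → Fin K → ℝ
  | 0 => 0
  | k + 1 => if N ∣ k + 1 then 0 else state q N A g k + q.inc (state q N A g k) (A k) (g k)

variable {q : Learner K} {N : ℕ}

theorem state_congr {A A' : ℕ → Fin K} {g g' : ℕ → ℝ} {n : ℕ} (hA : ∀ k < n, A k = A' k)
    (hg : ∀ k < n, g k = g' k) : q.state N A g n = q.state N A' g' n := by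
  induction n with
  | zero => rfl
  | succ n ih =>
    simp only [state]
    rw [ih (fun k hk => hA k (by omega)) (fun k hk => hg k (by omega)), hA n (by omega),
      hg n (by omega)]

theorem state_mul (A : ℕ → Fin K) (g : ℕ → ℝ) (j : ℕ) : q.state N A g (j * N) = 0 := by
  cases h : j * N with
  | zero => rfl
  | succ k => simp [state, ← h]

theorem state_add_one (A : ℕ → Fin K) (g : ℕ → ℝ) (j : ℕ) {k : ℕ} (hk : k + 1 < N) :
    q.state N A g (j * N + k + 1) = q.state N A g (j * N + k) +
      q.inc (q.state N A g (j * N + k)) (A (j * N + k)) (g (j * N + k)) := by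
  have h : ¬ N ∣ j * N + k + 1 := by
    intro h
    rw [add_assoc, Nat.dvd_add_right (Dvd.intro_left j rfl)] at h
    exact absurd (Nat.le_of_dvd (by omega) h) (by omega)
  rw [state, if_neg h]

theorem state_nonneg (hq : q.Valid) (A : ℕ → Fin K) {g : ℕ → ℝ} (hg : ∀ k, 0 ≤ g k) (n : ℕ)
    (s b : Fin K) : 0 ≤ q.state N A g n s b := by
  induction n generalizing s b with
  | zero => exact le_rfl
  | succ n ih =>
    rw [state]
    split_ifs
    · exact le_rfl
    · exact add_nonneg (ih s b) (inc_nonneg _ hq _ (hg n) s b)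

/-- Estimates are formed from gains rather than losses precisely for this: an arm that only collides
in the current block keeps the estimate `0` on every path, not merely on average. -/
theorem state_eq_zero (A : ℕ → Fin K) (g : ℕ → ℝ) (n : ℕ) (a : Fin K)
    (h : ∀ k, n / N * N ≤ k → k < n → A k = a → g k = 0) (s : Fin K) :
    q.state N A g n s a = 0 := by
  induction n with
  | zero => rfl
  | succ n ih =>
    rw [state]
    split_ifs with hd
    · rfl
    · have hdiv : (n + 1) / N = n / N := by rw [Nat.succ_div, if_neg hd, add_zero]
      rw [hdiv] at h
      rw [Pi.add_apply, Pi.add_apply, ih fun k h1 h2 => h k h1 (by omega), zero_add, inc]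
      split_ifs with ha
      · rw [h n (Nat.div_mul_le_self n N) (by omega) ha.symm]; simp
      · rfl

theorem sum_state_gain_le (hq : q.Valid) (hsteps : (K : ℝ) / (q.steps * q.expl) ≤ 1)
    (J : ℕ) (A : ℕ → Fin K) (g : ℕ → ℝ) (hA : ∀ k, A k ∈ q.arms)
    (hg0 : ∀ k, 0 ≤ g k) (hg1 : ∀ k, g k ≤ 1)
    (φ : ℕ → Fin K → Fin K) (hφ : ∀ j < J, ∀ s, φ j s ∈ q.arms) :
    ∑ k ∈ Finset.range (J * N), ∑ s, q.inc (q.state N A g k) (A k) (g k) s (φ (k / N) s) ≤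
      ∑ k ∈ Finset.range (J * N), (g k + (2 * q.expl + K / (q.steps * q.expl)) +
          3 * q.rate * (g k / q.dist (q.state N A g k) (A k))) +
        J * (K * (Real.log (1 + K * q.bias) - Real.log q.bias) / q.rate) := by
  rw [sum_range_mul_eq, sum_range_mul_eq]
  have h1 : (J : ℝ) * (K * (Real.log (1 + K * q.bias) - Real.log q.bias) / q.rate) =
      ∑ j ∈ Finset.range J, K * (Real.log (1 + K * q.bias) - Real.log q.bias) / q.rate := by
    simp
  rw [h1, ← Finset.sum_add_distrib]
  refine Finset.sum_le_sum fun j hj => ?_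
  have h := sum_estimated_gain_le hq hsteps N (fun k => q.state N A g (j * N + k))
    (fun k => A (j * N + k)) (fun k => g (j * N + k)) (fun k => hA _) (fun k => hg0 _)
    (fun k => hg1 _) (state_mul A g j) (fun k hk => state_add_one A g j hk) (φ j)
    (hφ j (Finset.mem_range.1 hj))
  refine le_trans (le_of_eq (Finset.sum_congr rfl fun k hk => ?_)) h
  have hk := Finset.mem_range.1 hk
  have : (j * N + k) / N = j := by
    rw [mul_comm, Nat.mul_add_div (by omega), Nat.div_eq_of_lt hk, add_zero]
  rw [this]

end Learner

/-! ### Assigning the arms of `S` to the players -/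

section Targets

variable {m K : ℕ}

/-- The home arm of player `i`. -/
def homeArm (h : m ≤ K) (i : Fin m) : Fin K := Fin.castLE h i

/-- The arms that player `i` may play: all arms but the home arms of the players after her. -/
def allowedArms (h : m ≤ K) (i : Fin m) : Finset (Fin K) :=
  Finset.univ.filter fun a => ∀ j, i < j → a ≠ homeArm h j

theorem homeArm_mem (h : m ≤ K) (i : Fin m) : homeArm h i ∈ allowedArms h i := by
  simp only [allowedArms, Finset.mem_filter, Finset.mem_univ, true_and]
  intro j hj he
  exact hj.ne (Fin.castLE_injective h he)

theorem ne_homeArm (h : m ≤ K) {i j : Fin m} (hij : i < j) {a : Fin K}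
    (ha : a ∈ allowedArms h i) : a ≠ homeArm h j :=
  (Finset.mem_filter.1 ha).2 j hij

theorem card_compl_allowedArms (h : m ≤ K) (i : Fin m) :
    (Finset.univ \ allowedArms h i).card ≤ m - 1 - i := by
  have : Finset.univ \ allowedArms h i ⊆ (Finset.Ioi i).image (homeArm h) := by
    intro a ha
    simp only [allowedArms, Finset.mem_sdiff, Finset.mem_univ, true_and, Finset.mem_filter,
      not_forall, not_not] at ha
    obtain ⟨j, hj, rfl⟩ := ha
    exact Finset.mem_image_of_mem _ (Finset.mem_Ioi.2 hj)
  refine (Finset.card_le_card this).trans (Finset.card_image_le.trans ?_)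
  simp

/-- The arm in `R ∩ P` that arm `s` is compared with: `s` itself if possible. -/
def target (P R : Finset (Fin K)) (d s : Fin K) : Fin K :=
  -- The default `d` is not reached for the sets `remaining` of a set `S` of `m` arms, by
  -- `remaining_inter_nonempty`.
  if s ∈ R ∩ P then s else if hR : (R ∩ P).Nonempty then (R ∩ P).min' hR else d

theorem target_mem {P R : Finset (Fin K)} (hR : (R ∩ P).Nonempty) (d s : Fin K) :
    target P R d s ∈ R ∩ P := by
  unfold target
  split_ifs with h
  · exact h
  · exact Finset.min'_mem _ _

theorem target_mem_right {P R : Finset (Fin K)} {d : Fin K} (hd : d ∈ P) (s : Fin K) :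
    target P R d s ∈ P := by
  unfold target
  split_ifs with h hR
  · exact (Finset.mem_inter.1 h).2
  · exact (Finset.mem_inter.1 (Finset.min'_mem _ hR)).2
  · exact hd

/-- What remains of the set `S` of comparison arms for the players `k, k + 1, …` when the players
choose the profile `a`. -/
def remaining (h : m ≤ K) (S : Finset (Fin K)) (a : Fin m → Fin K) : ℕ → Finset (Fin K)
  | 0 => S
  | k + 1 =>
    if hk : k < m then
      (remaining h S a k).erase
        (target (allowedArms h ⟨k, hk⟩) (remaining h S a k) (homeArm h ⟨k, hk⟩) (a ⟨k, hk⟩))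
    else remaining h S a k

/-- The arm that player `i` is compared with when she plays `s` and the others play `a`. -/
def comparator (h : m ≤ K) (S : Finset (Fin K)) (a : Fin m → Fin K) (i : Fin m) (s : Fin K) :
    Fin K :=
  target (allowedArms h i) (remaining h S a i) (homeArm h i) s

variable (h : m ≤ K) (S : Finset (Fin K)) (a : Fin m → Fin K)

theorem remaining_congr {a a' : Fin m → Fin K} (k : ℕ) (haa : ∀ j : Fin m, j.1 < k → a j = a' j) :
    remaining h S a k = remaining h S a' k := by
  induction k with
  | zero => rfl
  | succ k ih =>
    simp only [remaining]
    rw [ih fun j hj => haa j (by omega)]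
    split_ifs with hk
    · rw [haa ⟨k, hk⟩ (by simp)]
    · rfl

theorem comparator_congr {a a' : Fin m → Fin K} (i : Fin m) (haa : ∀ j < i, a j = a' j)
    (s : Fin K) : comparator h S a i s = comparator h S a' i s := by
  rw [comparator, remaining_congr h S i fun j hj => haa j hj]
  rfl

theorem comparator_mem_allowed (i : Fin m) (s : Fin K) :
    comparator h S a i s ∈ allowedArms h i :=
  target_mem_right (homeArm_mem h i) s

theorem remaining_succ (i : Fin m) :
    remaining h S a (i + 1) = (remaining h S a i).erase (comparator h S a i (a i)) := by
  simp [remaining, comparator]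

variable {S a}

/-- Pigeonhole: `m - i` arms are left, and at most `m - 1 - i` arms, the homes of the later players,
are forbidden. -/
theorem remaining_inter_nonempty (i : Fin m) (hc : (remaining h S a i).card = m - i) :
    (remaining h S a i ∩ allowedArms h i).Nonempty := by
  by_contra hne
  rw [Finset.not_nonempty_iff_eq_empty, ← Finset.disjoint_iff_inter_eq_empty] at hne
  have hsub : remaining h S a i ⊆ Finset.univ \ allowedArms h i := fun x hx =>
    Finset.mem_sdiff.2 ⟨Finset.mem_univ x, fun hx' => Finset.disjoint_left.1 hne hx hx'⟩
  have := (Finset.card_le_card hsub).trans (card_compl_allowedArms h i)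
  have := i.2
  omega

theorem card_remaining (hS : S.card = m) (k : ℕ) (hk : k ≤ m) :
    (remaining h S a k).card = m - k := by
  induction k with
  | zero => simpa [remaining] using hS
  | succ k ih =>
    have ih := ih (by omega)
    have hne := remaining_inter_nonempty h ⟨k, hk⟩ ih
    rw [remaining_succ h S a ⟨k, hk⟩, Finset.card_erase_of_mem, ih]
    · omega
    · exact (Finset.mem_inter.1 (target_mem hne _ _)).1

theorem comparator_mem (hS : S.card = m) (i : Fin m) (s : Fin K) :
    comparator h S a i s ∈ remaining h S a i :=
  (Finset.mem_inter.1 (target_mem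
    (remaining_inter_nonempty h i (card_remaining h hS i i.2.le)) _ _)).1

/-- If the arm of `j` is still there at her turn, it is her own target, being allowed, and is
erased; the sets only shrink afterwards. -/
theorem notMem_remaining (ha : ∀ i, a i ∈ allowedArms h i) (k : ℕ) (hk : k ≤ m) (j : Fin m)
    (hj : j.1 < k) : a j ∉ remaining h S a k := by
  induction k with
  | zero => omega
  | succ k ih =>
    rw [remaining_succ h S a ⟨k, hk⟩, Finset.mem_erase, not_and]
    rcases Nat.lt_succ_iff_lt_or_eq.1 hj with hjk | hjk
    · exact fun _ => ih (by omega) hjk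
    · have : j = ⟨k, hk⟩ := Fin.ext hjk
      subst this
      intro hne hmem
      refine hne ?_
      rw [comparator, target, if_pos (Finset.mem_inter.2 ⟨hmem, ha _⟩)]

/-- A comparison arm is therefore never blocked by an earlier player, and only collisions with later
players remain to be controlled. -/
theorem comparator_ne (hS : S.card = m) (ha : ∀ i, a i ∈ allowedArms h i) {i j : Fin m}
    (hji : j < i) (s : Fin K) : comparator h S a i s ≠ a j := fun he =>
  notMem_remaining h ha i i.2.le j hji (he ▸ comparator_mem h hS i s)

/-- Each player erases exactly her comparison arm, and after `m` erasures nothing is left of `S`. -/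
theorem sum_comparator (hS : S.card = m) (f : Fin K → ℝ) :
    ∑ i, f (comparator h S a i (a i)) = ∑ b ∈ S, f b := by
  have key : ∀ k (hk : k ≤ m), ∑ i : Fin k, f (comparator h S a (Fin.castLE hk i)
      (a (Fin.castLE hk i))) + ∑ b ∈ remaining h S a k, f b = ∑ b ∈ S, f b := by
    intro k hk
    induction k with
    | zero => simp [remaining]
    | succ k ih =>
      rw [← ih (by omega), Fin.sum_univ_castSucc]
      have h1 : remaining h S a (k + 1) = _ := remaining_succ h S a ⟨k, hk⟩
      have h2 := Finset.sum_erase_add _ f (comparator_mem h hS (a := a) ⟨k, hk⟩ (a ⟨k, hk⟩))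
      rw [← h1] at h2
      rw [add_assoc]
      congr 1
      rw [← h2, add_comm]
      rfl
  have hk := key m le_rfl
  have h0 : remaining h S a m = ∅ := by
    rw [← Finset.card_eq_zero, card_remaining h hS m le_rfl]; omega
  rw [h0, Finset.sum_empty, add_zero] at hk
  exact hk

end Targets

/-! ### Losses and collisions -/

section SufferedLoss

variable {m K : ℕ} {l : Fin K → ℝ} {a : Fin m → Fin K}

theorem sufferedLoss_le_one (hl : ∀ b, l b ∈ Set.Icc (0 : ℝ) 1) (i : Fin m) :
    sufferedLoss l a i ≤ 1 := by
  unfold sufferedLoss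
  refine max_le (hl _).2 ?_
  split_ifs <;> norm_num

theorem le_sufferedLoss (i : Fin m) : l (a i) ≤ sufferedLoss l a i := le_max_left _ _

theorem sufferedLoss_nonneg (i : Fin m) : 0 ≤ sufferedLoss l a i := by
  unfold sufferedLoss
  refine le_max_of_le_right ?_
  split_ifs <;> norm_num

theorem sufferedLoss_eq_one (hl : ∀ b, l b ∈ Set.Icc (0 : ℝ) 1) {i j : Fin m} (hj : j ≠ i)
    (hc : a j = a i) : sufferedLoss l a i = 1 := by
  unfold sufferedLoss
  rw [if_pos ⟨j, hj, hc⟩, max_eq_right (hl _).2]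

/-- If the players before `i` do not collide with her, the gain of `i` is reduced only by
collisions with the players after her. -/
theorem sub_sum_le_one_sub_sufferedLoss (hl : ∀ b, l b ∈ Set.Icc (0 : ℝ) 1) {i : Fin m}
    (hlt : ∀ j < i, a j ≠ a i) :
    (1 - l (a i)) - ∑ j ∈ Finset.Ioi i, (if a j = a i then (1 : ℝ) else 0) ≤
      1 - sufferedLoss l a i := by
  have h0 : ∀ j ∈ Finset.Ioi i, (0 : ℝ) ≤ if a j = a i then (1 : ℝ) else 0 := by
    intro j _; split_ifs <;> norm_num
  by_cases hc : ∃ j, j ≠ i ∧ a j = a i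
  · obtain ⟨j, hj, hji⟩ := hc
    have hlt' : i < j := lt_of_le_of_ne (not_lt.1 fun h => hlt j h hji) hj.symm
    have h1 := Finset.single_le_sum h0 (Finset.mem_Ioi.2 hlt')
    rw [if_pos hji] at h1
    linarith [sufferedLoss_le_one hl i (a := a), (hl (a i)).1]
  · have : sufferedLoss l a i = l (a i) := by
      unfold sufferedLoss
      rw [if_neg hc, max_eq_left (hl _).1]
    rw [this]
    linarith [Finset.sum_nonneg h0]

end SufferedLoss

end MultiBandit

/-! ### Time scales, and the learners along a path of action profiles -/

namespace MultiBandit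

variable {m K : ℕ}

/-- The learner that player `i` runs on the sub-blocks of each of her blocks. -/
noncomputable def learner (h : m ≤ K) (N : ℕ) (i : Fin m) : Learner K where
  home := homeArm h i
  arms := allowedArms h i
  rate := 1 / √N
  expl := K / √N
  bias := 1 / N
  steps := N

/-- The condition `4 * K ^ 2 ≤ N` amounts to `expl ≤ 1 / 2`. The choice of `expl` makes `rate * K ≤
expl` an equality. -/
theorem learner_valid (h : m ≤ K) {N : ℕ} (hN : 4 * K ^ 2 ≤ N) (i : Fin m) :
    (learner h N i).Valid := by
  have hK : 0 < K := i.pos.trans_le h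
  have hN0 : 0 < N := lt_of_lt_of_le (by positivity) hN
  have hs : 0 < √(N : ℝ) := Real.sqrt_pos.2 (Nat.cast_pos.2 hN0)
  have h2 : 2 * (K : ℝ) ≤ √N := by
    apply Real.le_sqrt_of_sq_le
    have : ((4 * K ^ 2 : ℕ) : ℝ) ≤ N := Nat.cast_le.2 hN
    push_cast at this
    nlinarith
  have hKr : (0 : ℝ) < K := Nat.cast_pos.2 hK
  refine ⟨homeArm_mem h i, ?_, ?_, ?_, ?_, ?_, hN0, ?_⟩
  · exact div_pos one_pos hs
  · exact div_pos hKr hs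
  · show (K : ℝ) / √N ≤ 1 / 2
    rw [div_le_div_iff₀ hs two_pos]; linarith
  · exact div_pos one_pos (Nat.cast_pos.2 hN0)
  · show (1 : ℝ) / N ≤ 1
    rw [div_le_one (Nat.cast_pos.2 hN0)]
    exact_mod_cast hN0
  · show 1 / √(N : ℝ) * K ≤ K / √N
    rw [one_div_mul_eq_div]

/-- The number of consecutive rounds in which player `i` keeps her arm. -/
def blockLen (m N : ℕ) (i : Fin m) : ℕ := N ^ (m - 1 - i)

theorem blockLen_pos {N : ℕ} (hN : 0 < N) (i : Fin m) : 0 < blockLen m N i := pow_pos hN _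

/-- In `N ^ m` rounds, player `i` has `N ^ i` blocks, each made of `N` sub-blocks. -/
theorem pow_mul_blockLen (N : ℕ) (i : Fin m) : N ^ (i : ℕ) * N * blockLen m N i = N ^ m := by
  rw [blockLen, ← pow_succ, ← pow_add]
  congr 1
  have := i.2
  omega

/-- A sub-block of `i` is a union of whole blocks of each later player `j`; this is why `i` stands
still during a block of `j`. -/
theorem exists_blockLen_eq (N : ℕ) {i j : Fin m} (hij : i < j) :
    ∃ c, blockLen m N i = N * blockLen m N j * c := by
  refine ⟨N ^ (j.1 - i.1 - 1), ?_⟩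
  rw [blockLen, blockLen, ← pow_succ', ← pow_add]
  congr 1
  have := j.2
  have : i.1 < j.1 := hij
  omega

/-- The average gain of player `i` in her sub-block `k`. -/
noncomputable def avgGain (N : ℕ) (l : ℕ → Fin K → ℝ) (α : ℕ → Fin m → Fin K) (i : Fin m)
    (k : ℕ) : ℝ :=
  (∑ r ∈ Finset.range (blockLen m N i),
    (1 - sufferedLoss (l (k * blockLen m N i + r)) (α (k * blockLen m N i + r)) i)) /
      blockLen m N i

/-- The estimated gains of player `i` at the beginning of her sub-block `k`. -/
noncomputable def pathState (h : m ≤ K) (N : ℕ) (l : ℕ → Fin K → ℝ) (i : Fin m) (k : ℕ)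
    (α : ℕ → Fin m → Fin K) : Fin K → Fin K → ℝ :=
  (learner h N i).state N (fun k => α (k * blockLen m N i) i) (avgGain N l α i) k

section Path

variable {N : ℕ} {l : ℕ → Fin K → ℝ} {α β : ℕ → Fin m → Fin K}

theorem avgGain_nonneg (hl : ∀ t b, l t b ∈ Set.Icc (0 : ℝ) 1) (i : Fin m) (k : ℕ) :
    0 ≤ avgGain N l α i k :=
  div_nonneg (Finset.sum_nonneg fun _ _ => sub_nonneg.2 (sufferedLoss_le_one (hl _) i))
    (Nat.cast_nonneg _)

theorem avgGain_le_one (i : Fin m) (k : ℕ) : avgGain N l α i k ≤ 1 := by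
  refine div_le_one_of_le₀ ?_ (Nat.cast_nonneg _)
  refine (Finset.sum_le_card_nsmul _ _ 1 fun r _ => ?_).trans (by simp)
  linarith [sufferedLoss_nonneg (l := l (k * blockLen m N i + r))
    (a := α (k * blockLen m N i + r)) i]

theorem avgGain_congr (i : Fin m) (k : ℕ)
    (h : ∀ s < (k + 1) * blockLen m N i, α s = β s) : avgGain N l α i k = avgGain N l β i k := by
  unfold avgGain
  congr 1
  refine Finset.sum_congr rfl fun r hr => ?_
  have := Finset.mem_range.1 hr
  rw [h _ (by rw [Nat.succ_mul]; omega)]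

theorem pathState_congr (h : m ≤ K) (hN : 0 < N) (i : Fin m) (k : ℕ)
    (hs : ∀ s < k * blockLen m N i, α s = β s) :
    pathState h N l i k α = pathState h N l i k β := by
  refine Learner.state_congr (fun n hn => ?_) (fun n hn => avgGain_congr i n fun s hs' => ?_)
  · rw [hs _ ((Nat.mul_lt_mul_right (blockLen_pos hN i)).2 hn)]
  · exact hs s (hs'.trans_le (Nat.mul_le_mul_right _ hn))

variable (h : m ≤ K) (N l) (S : Finset (Fin K))

/-- The comparison arm of player `i` in her sub-block `k`; it is constant over her blocks. -/
noncomputable def blockComparator (i : Fin m) (k : ℕ) (α : ℕ → Fin m → Fin K) (s : Fin K) :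
    Fin K :=
  comparator h S (α (k / N * N * blockLen m N i)) i s

/-- The importance weight with which the gain of arm `b`, played by `i` in her sub-block `k`,
enters the estimate of the gain of the comparison arms. -/
noncomputable def estWeight (i : Fin m) (k : ℕ) (b : Fin K) (α : ℕ → Fin m → Fin K) : ℝ :=
  ∑ s, (learner h N i).inc (pathState h N l i k α) b 1 s (blockComparator N h S i k α s)

variable {N l S}

/-- Dependence on the simultaneous arms of the players before `i` cannot be excluded: at the start
of a block of `i`, they may draw new arms in the same round. Independence of the players makes it
harmless. -/
theorem blockComparator_congr (i : Fin m) (k : ℕ)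
    (hs : ∀ s < k * blockLen m N i, α s = β s)
    (hi : ∀ j < i, α (k * blockLen m N i) j = β (k * blockLen m N i) j) (s : Fin K) :
    blockComparator N h S i k α s = blockComparator N h S i k β s := by
  refine comparator_congr h S i (fun j hj => ?_) s
  have hle : k / N * N * blockLen m N i ≤ k * blockLen m N i :=
    Nat.mul_le_mul_right _ (Nat.div_mul_le_self k N)
  rcases hle.lt_or_eq with hlt | heq
  · rw [hs _ hlt]
  · rw [heq, hi j hj]

theorem estWeight_congr (hN : 0 < N) (i : Fin m) (k : ℕ) (b : Fin K)
    (hs : ∀ s < k * blockLen m N i, α s = β s)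
    (hi : ∀ j < i, α (k * blockLen m N i) j = β (k * blockLen m N i) j) :
    estWeight N l h S i k b α = estWeight N l h S i k b β := by
  unfold estWeight
  rw [pathState_congr h hN i k hs]
  simp_rw [blockComparator_congr h i k hs hi]

theorem estWeight_nonneg {i : Fin m} (hq : (learner h N i).Valid) (k : ℕ) (b : Fin K) :
    0 ≤ estWeight N l h S i k b α :=
  Finset.sum_nonneg fun _ _ => Learner.inc_nonneg _ hq _ zero_le_one _ _

theorem sum_inc_eq (i : Fin m) (k : ℕ) (b : Fin K) (g : ℝ) :
    ∑ s, (learner h N i).inc (pathState h N l i k α) b g s (blockComparator N h S i k α s) =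
      estWeight N l h S i k b α * g := by
  rw [estWeight, Finset.sum_mul]
  refine Finset.sum_congr rfl fun s _ => ?_
  unfold Learner.inc
  split_ifs <;> ring

/-- Unbiasedness of importance weighting: `dist` cancels, and each row `s` contributes the value of
its own comparison arm with weight `base s`. -/
theorem sum_dist_mul_estWeight {i : Fin m} (hq : (learner h N i).Valid) (k : ℕ)
    (v : Fin K → ℝ) :
    ∑ b, (learner h N i).dist (pathState h N l i k α) b * (estWeight N l h S i k b α * v b) =
      ∑ s, (learner h N i).base (pathState h N l i k α) s * v (blockComparator N h S i k α s) := by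
  simp only [estWeight, Finset.sum_mul, Finset.mul_sum]
  rw [Finset.sum_comm]
  refine Finset.sum_congr rfl fun s _ => ?_
  rw [Finset.sum_eq_single (blockComparator N h S i k α s)]
  · have := (Learner.dist_pos (pathState h N l i k α) hq
      (comparator_mem_allowed h S (α (k / N * N * blockLen m N i)) i s)).ne'
    simp only [Learner.inc, if_true]
    change _ * (_ / (learner h N i).dist (pathState h N l i k α)
      (blockComparator N h S i k α s) * _) = _
    field_simp [show (learner h N i).dist (pathState h N l i k α)
      (blockComparator N h S i k α s) ≠ 0 from this]
  · intro b _ hb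
    simp [Learner.inc, hb.symm]
  · simp

end Path

/-- A random path `α` of the action profiles whose players keep their arms on their sub-blocks,
and choose them independently with the distributions of their learners. -/
structure IsLearnerProcess {Ω : Type*} [MeasurableSpace Ω] (μ : Measure Ω) (h : m ≤ K) (N T : ℕ)
    (l : ℕ → Fin K → ℝ) (α : Ω → ℕ → Fin m → Fin K) : Prop where
  mem : ∀ ω t i, α ω t i ∈ allowedArms h i
  block : ∀ ω t i, t < T → α ω t i = α ω (t / blockLen m N i * blockLen m N i) i
  integrable : ∀ f : (ℕ → Fin m → Fin K) → ℝ, Integrable (fun ω => f (α ω)) μ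
  -- The function `f` may use the past and the simultaneous arms of the other players, but nothing
  -- that depends on the draw of `i` except through its first argument.
  sample : ∀ i k, k * blockLen m N i < T → ∀ f : Fin K → (ℕ → Fin m → Fin K) → ℝ,
    (∀ b β β', (∀ s < k * blockLen m N i, β s = β' s) →
      (∀ j ≠ i, β (k * blockLen m N i) j = β' (k * blockLen m N i) j) → f b β = f b β') →
    ∫ ω, f (α ω (k * blockLen m N i) i) (α ω) ∂μ =
      ∫ ω, ∑ b, (learner h N i).dist (pathState h N l i k (α ω)) b * f b (α ω) ∂μ

/-! ### Expected estimates: unbiasedness and the cost of collisions -/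

section Expectation

variable {Ω : Type*} [MeasurableSpace Ω] {μ : Measure Ω} {h : m ≤ K} {N T : ℕ}
  {l : ℕ → Fin K → ℝ} {α : Ω → ℕ → Fin m → Fin K}

theorem IsLearnerProcess.integral_estWeight (hα : IsLearnerProcess μ h N T l α) {i : Fin m}
    (hN : 0 < N) (hq : (learner h N i).Valid) (S : Finset (Fin K)) {k : ℕ}
    (hk : k * blockLen m N i < T) (v : Fin K → ℝ) :
    ∫ ω, estWeight N l h S i k (α ω (k * blockLen m N i) i) (α ω) *
        v (α ω (k * blockLen m N i) i) ∂μ =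
      ∫ ω, ∑ s, (learner h N i).base (pathState h N l i k (α ω)) s *
        v (blockComparator N h S i k (α ω) s) ∂μ := by
  rw [hα.sample i k hk (fun b β => estWeight N l h S i k b β * v b)]
  · simp_rw [sum_dist_mul_estWeight h hq]
  · intro b β β' hs hi
    rw [estWeight_congr h hN i k b hs fun j hj => hi j hj.ne]

/-- The times `u` and `t` lie in one block of `j`, hence in one sub-block of `i`. -/
theorem IsLearnerProcess.eq_of_lt (hα : IsLearnerProcess μ h N T l α) {i j : Fin m}
    (hN : 0 < N) (hij : i < j) (ω : Ω) {t : ℕ} (ht : t < T) {u : ℕ} (hu : u ≤ t)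
    (hu' : t / blockLen m N j / N * N * blockLen m N j ≤ u) : α ω u i = α ω t i := by
  obtain ⟨c, hc⟩ := exists_blockLen_eq N hij
  have hB := blockLen_pos hN i
  have h1 : t / blockLen m N i * blockLen m N i ≤
      t / blockLen m N j / N * N * blockLen m N j := by
    rw [hc, ← Nat.div_div_eq_div_mul, mul_comm N, ← Nat.div_div_eq_div_mul]
    calc _ = t / blockLen m N j / N / c * c * (N * blockLen m N j) := by ring
      _ ≤ t / blockLen m N j / N * (N * blockLen m N j) :=
          Nat.mul_le_mul_right _ (Nat.div_mul_le_self _ _)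
      _ = _ := by ring
  have h2 : u / blockLen m N i = t / blockLen m N i := by
    refine le_antisymm (Nat.div_le_div_right hu) ?_
    rw [Nat.le_div_iff_mul_le hB]
    exact h1.trans hu'
  rw [hα.block ω u i (hu.trans_lt ht), hα.block ω t i ht, h2]

/-- The comparison arm, as a function of the own arm, depends only on the earlier players, who stand
still during a block of `i`. So it is a fixed swap function for the learner in that block. -/
theorem IsLearnerProcess.blockComparator_eq (hα : IsLearnerProcess μ h N T l α) (i : Fin m)
    (hN : 0 < N) (S : Finset (Fin K)) (ω : Ω) {t : ℕ} (ht : t < T) (s : Fin K) :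
    blockComparator N h S i (t / blockLen m N i) (α ω) s = comparator h S (α ω t) i s := by
  refine comparator_congr h S i (fun j hj => ?_) s
  refine hα.eq_of_lt hN hj ω ht ?_ le_rfl
  exact (Nat.mul_le_mul_right _ (Nat.div_mul_le_self _ _)).trans (Nat.div_mul_le_self _ _)

variable [IsProbabilityMeasure μ]

/-- A player after `i` rarely hits the arm of `i`. -/
theorem IsLearnerProcess.integral_estWeight_collision_le (hα : IsLearnerProcess μ h N T l α)
    {i j : Fin m} (hij : i < j) (hN : 0 < N) (hq : ∀ i, (learner h N i).Valid)
    (hl : ∀ t b, l t b ∈ Set.Icc (0 : ℝ) 1) (S : Finset (Fin K)) {t : ℕ} (ht : t < T) :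
    ∫ ω, estWeight N l h S i (t / blockLen m N i) (α ω t i) (α ω) *
        (if α ω t j = α ω t i then 1 else 0) ∂μ ≤
      (learner h N j).bias + (learner h N j).expl / K := by
  set k := t / blockLen m N i with hk
  set k' := t / blockLen m N j with hk'
  have hBi := blockLen_pos hN i
  have hBj := blockLen_pos hN j
  have hk't : k' * blockLen m N j ≤ t := Nat.div_mul_le_self _ _
  have hkt : k * blockLen m N i ≤ t := Nat.div_mul_le_self _ _
  have hkk' : k * blockLen m N i ≤ k' * blockLen m N j := by
    obtain ⟨c, hc⟩ := exists_blockLen_eq N hij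
    have hc' : blockLen m N i = blockLen m N j * (N * c) := by rw [hc]; ring
    rw [hk, hk', hc', ← Nat.div_div_eq_div_mul]
    calc _ = t / blockLen m N j / (N * c) * (N * c) * blockLen m N j := by ring
      _ ≤ _ := Nat.mul_le_mul_right _ (Nat.div_mul_le_self _ _)
  have hEone : ∫ ω, estWeight N l h S i k (α ω (k * blockLen m N i) i) (α ω) ∂μ = 1 := by
    have := hα.integral_estWeight hN (hq i) S (hkt.trans_lt ht) (fun _ => 1)
    simpa [Learner.sum_base _ (hq i)] using this
  have hblk : ∀ ω, α ω t i = α ω (k * blockLen m N i) i := fun ω => hα.block ω t i ht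
  have hblk' : ∀ ω, α ω t j = α ω (k' * blockLen m N j) j := fun ω => hα.block ω t j ht
  simp_rw [hblk', hblk]
  -- The weight of `i` is already determined when `j` draws, or depends on simultaneous draws of
  -- players other than `j`. So the draw of `j` can be averaged first; the weight itself has mean
  -- `1`, however large its values.
  rw [hα.sample j k' (hk't.trans_lt ht) (fun b β => estWeight N l h S i k
    (β (k * blockLen m N i) i) β * if b = β (k * blockLen m N i) i then 1 else 0)]
  · calc _ ≤ ∫ ω, estWeight N l h S i k (α ω (k * blockLen m N i) i) (α ω) *
          ((learner h N j).bias + (learner h N j).expl / K) ∂μ := by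
          refine integral_mono
            (hα.integrable fun β => ∑ b, (learner h N j).dist (pathState h N l j k' β) b *
              (estWeight N l h S i k (β (k * blockLen m N i) i) β *
                if b = β (k * blockLen m N i) i then 1 else 0))
            (hα.integrable fun β => estWeight N l h S i k (β (k * blockLen m N i) i) β * _)
            fun ω => ?_
          simp only [mul_ite, mul_one, mul_zero, Finset.sum_ite_eq', Finset.mem_univ, if_true]
          rw [mul_comm]
          refine mul_le_mul_of_nonneg_left ?_ (estWeight_nonneg h (hq i) _ _)
          -- Since her block began, whenever `j` tried the present arm of `i` she collided during
          -- the whole sub-block, because `i` has not moved. Hence its estimated gain is `0`.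
          refine Learner.dist_le_of_no_gain _ (hq j)
            (Learner.state_nonneg (hq j) _ (avgGain_nonneg hl j) _) ?_
            (Learner.state_eq_zero _ _ _ _ fun n hn1 hn2 hn3 => ?_)
          · exact ne_homeArm h hij (hα.mem ω _ i)
          · rw [avgGain, Finset.sum_eq_zero, zero_div]
            intro r hr
            have hr := Finset.mem_range.1 hr
            have hut : n * blockLen m N j + r ≤ t := by
              have : (n + 1) * blockLen m N j ≤ k' * blockLen m N j := Nat.mul_le_mul_right _ hn2
              rw [Nat.succ_mul] at this
              omega
            have hi' : α ω (n * blockLen m N j + r) i = α ω t i :=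
              hα.eq_of_lt hN hij ω ht hut ((Nat.mul_le_mul_right _ hn1).trans (Nat.le_add_right _ _))
            have hj' : α ω (n * blockLen m N j + r) j = α ω (n * blockLen m N j) j := by
              rw [hα.block ω _ j (hut.trans_lt ht), mul_comm n, Nat.mul_add_div hBj,
                Nat.div_eq_of_lt hr, add_zero, mul_comm]
            rw [sufferedLoss_eq_one (hl _) hij.ne, sub_self]
            rw [hi', hj', hblk]
            exact hn3.symm
      _ = _ := by rw [integral_mul_const, hEone, one_mul]
  · intro b β β' hs hi
    have hi1 : ∀ p ≤ i, β (k * blockLen m N i) p = β' (k * blockLen m N i) p := by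
      intro p hp
      rcases hkk'.lt_or_eq with hlt | heq
      · rw [hs _ hlt]
      · rw [heq, hi p (hp.trans_lt hij).ne]
    rw [hi1 i le_rfl, estWeight_congr h hN i k _ (fun s hs' => hs s (hs'.trans_le hkk'))
      fun p hp => hi1 p hp.le]

/-- The arm is drawn from `dist`, while the estimates refer to `base`; as `dist ≤ base + expl *
explore`, the discrepancy costs at most `expl`. -/
theorem IsLearnerProcess.integral_comparator_le (hα : IsLearnerProcess μ h N T l α) {i : Fin m}
    (hq : (learner h N i).Valid) (S : Finset (Fin K)) {k : ℕ}
    (hk : k * blockLen m N i < T) (v : Fin K → ℝ) (hv : ∀ b, v b ∈ Set.Icc (0 : ℝ) 1) :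
    ∫ ω, v (blockComparator N h S i k (α ω) (α ω (k * blockLen m N i) i)) ∂μ ≤
      ∫ ω, ∑ s, (learner h N i).base (pathState h N l i k (α ω)) s *
        v (blockComparator N h S i k (α ω) s) ∂μ + (learner h N i).expl := by
  rw [hα.sample i k hk (fun b β => v (blockComparator N h S i k β b))]
  · have h1 : (learner h N i).expl = ∫ ω, (learner h N i).expl ∂μ := by simp
    rw [h1, ← integral_add (hα.integrable fun β =>
      ∑ s, (learner h N i).base (pathState h N l i k β) s * v (blockComparator N h S i k β s))
      (integrable_const _)]
    refine integral_mono (hα.integrable fun β => ∑ b, (learner h N i).dist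
      (pathState h N l i k β) b * v (blockComparator N h S i k β b))
      (hα.integrable fun β => ∑ s, (learner h N i).base (pathState h N l i k β) s *
        v (blockComparator N h S i k β s) + (learner h N i).expl) fun ω => ?_
    have h2 : (learner h N i).expl = ∑ s, (learner h N i).expl * (learner h N i).explore s := by
      rw [← Finset.mul_sum, Learner.sum_explore, mul_one]
    simp only
    rw [h2, ← Finset.sum_add_distrib]
    refine Finset.sum_le_sum fun s _ => ?_
    have h3 := Learner.dist_le (pathState h N l i k (α ω)) hq s
    have h4 := hv (blockComparator N h S i k (α ω) s)
    have h5 := mul_le_mul_of_nonneg_right h3 h4.1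
    have h6 := mul_nonneg hq.expl_pos.le (Learner.explore_nonneg (q := learner h N i) s)
    nlinarith [h4.2, mul_nonneg h6 (sub_nonneg.2 h4.2)]
  · intro b β β' hs hi
    rw [blockComparator_congr h i k hs fun j hj => hi j hj.ne]

/-- The estimated gain in round `t` dominates, in expectation, the gain of the comparison arm. -/
theorem IsLearnerProcess.integral_comparator_gain_le (hα : IsLearnerProcess μ h N T l α)
    (i : Fin m) (hN : 0 < N) (hq : ∀ i, (learner h N i).Valid)
    (hl : ∀ t b, l t b ∈ Set.Icc (0 : ℝ) 1) {S : Finset (Fin K)} (hS : S.card = m) {t : ℕ}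
    (ht : t < T) :
    ∫ ω, (1 - l t (comparator h S (α ω t) i (α ω t i))) ∂μ ≤
      ∫ ω, estWeight N l h S i (t / blockLen m N i)
          (α ω (t / blockLen m N i * blockLen m N i) i) (α ω) *
        (1 - sufferedLoss (l t) (α ω t) i) ∂μ +
      (K / √N + m * (1 / N + 1 / √N)) := by
  set k := t / blockLen m N i with hk
  have hkt : k * blockLen m N i < T := (Nat.div_mul_le_self _ _).trans_lt ht
  have hblk : ∀ ω, α ω t i = α ω (k * blockLen m N i) i := fun ω => hα.block ω t i ht
  have hK : (K : ℝ) ≠ 0 := Nat.cast_ne_zero.2 (i.pos.trans_le h).ne'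
  have h1 := hα.integral_comparator_le (hq i) S hkt (fun b => 1 - l t b)
    (fun b => ⟨sub_nonneg.2 (hl t b).2, sub_le_self _ (hl t b).1⟩)
  rw [← hα.integral_estWeight hN (hq i) S hkt (fun b => 1 - l t b)] at h1
  have h2 : ∀ j ∈ Finset.Ioi i, ∫ ω, estWeight N l h S i k (α ω t i) (α ω) *
        (if α ω t j = α ω t i then 1 else 0) ∂μ ≤ 1 / N + 1 / √N := by
    intro j hj
    refine (hα.integral_estWeight_collision_le (Finset.mem_Ioi.1 hj) hN hq hl S ht).trans_eq ?_
    simp only [learner]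
    field_simp
  have h3 : ∫ ω, (estWeight N l h S i k (α ω t i) (α ω) * (1 - l t (α ω t i)) -
      ∑ j ∈ Finset.Ioi i, estWeight N l h S i k (α ω t i) (α ω) *
        (if α ω t j = α ω t i then 1 else 0)) ∂μ ≤
      ∫ ω, estWeight N l h S i k (α ω t i) (α ω) *
        (1 - sufferedLoss (l t) (α ω t) i) ∂μ := by
    refine integral_mono (hα.integrable fun β => estWeight N l h S i k (β t i) β *
      (1 - l t (β t i)) - ∑ j ∈ Finset.Ioi i, estWeight N l h S i k (β t i) β *
        (if β t j = β t i then 1 else 0))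
      (hα.integrable fun β => estWeight N l h S i k (β t i) β *
        (1 - sufferedLoss (l t) (β t) i)) fun ω => ?_
    simp only
    rw [← Finset.mul_sum, ← mul_sub]
    -- A nonzero weight means that the arm of `i` is a comparison arm of some `s`, hence is not held
    -- by an earlier player.
    by_cases hex : ∃ s, comparator h S (α ω t) i s = α ω t i
    · obtain ⟨s, hs⟩ := hex
      refine mul_le_mul_of_nonneg_left (sub_sum_le_one_sub_sufferedLoss (hl t) fun j hj => ?_)
        (estWeight_nonneg h (hq i) _ _)
      rw [← hs]
      exact (comparator_ne h hS (hα.mem ω t) hj s).symm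
    · have : estWeight N l h S i k (α ω t i) (α ω) = 0 := by
        refine Finset.sum_eq_zero fun s _ => ?_
        rw [Learner.inc, if_neg]
        rw [hα.blockComparator_eq i hN S ω ht]
        exact fun hs => hex ⟨s, hs⟩
      rw [this, zero_mul, zero_mul]
  rw [integral_sub (hα.integrable fun β => estWeight N l h S i k (β t i) β * (1 - l t (β t i)))
    (hα.integrable fun β => ∑ j ∈ Finset.Ioi i, estWeight N l h S i k (β t i) β *
        (if β t j = β t i then 1 else 0)),
    integral_finsetSum _ fun j _ => hα.integrable fun β => estWeight N l h S i k (β t i) β *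
        (if β t j = β t i then 1 else 0)] at h3
  have h4 := Finset.sum_le_sum h2
  rw [Finset.sum_const, nsmul_eq_mul] at h4
  have h5 : ((Finset.Ioi i).card : ℝ) * (1 / N + 1 / √N) ≤ m * (1 / N + 1 / √N) := by
    gcongr
    exact (Finset.card_le_univ _).trans_eq (Fintype.card_fin m)
  have h6 : (learner h N i).expl = K / √N := rfl
  rw [h6] at h1
  have h7 : ∀ ω, blockComparator N h S i k (α ω) (α ω (k * blockLen m N i) i) =
      comparator h S (α ω t) i (α ω t i) := fun ω => by
    rw [hα.blockComparator_eq i hN S ω ht, hblk]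
  simp_rw [h7] at h1
  simp_rw [hblk] at h1 h3 h4 ⊢
  linarith

end Expectation

end MultiBandit

/-! ### Regret of one player and of all players -/

namespace MultiBandit

section PlayerRegret

variable {m K : ℕ} {Ω : Type*} [MeasurableSpace Ω] {μ : Measure Ω} {h : m ≤ K} {N T : ℕ}
  {l : ℕ → Fin K → ℝ} {α : Ω → ℕ → Fin m → Fin K}

/-- The pathwise regret bound of player `i`. -/
theorem IsLearnerProcess.sum_estWeight_le (hα : IsLearnerProcess μ h N T l α) (i : Fin m)
    (hN : 0 < N) (hq : (learner h N i).Valid) (hl : ∀ t b, l t b ∈ Set.Icc (0 : ℝ) 1)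
    (hlT : ∀ t b, T ≤ t → l t b = 1) (hT : T ≤ N ^ m) (S : Finset (Fin K)) (ω : Ω) :
    ∑ t ∈ Finset.range T, estWeight N l h S i (t / blockLen m N i)
          (α ω (t / blockLen m N i * blockLen m N i) i) (α ω) *
        (1 - sufferedLoss (l t) (α ω t) i) ≤
      ∑ t ∈ Finset.range T, (1 - sufferedLoss (l t) (α ω t) i) +
      (N : ℝ) ^ m * (2 * (K / √N) + 1 / √N) +
      3 * (1 / √N) * blockLen m N i * ∑ k ∈ Finset.range (N ^ (i : ℕ) * N),
        avgGain N l (α ω) i k / (learner h N i).dist (pathState h N l i k (α ω))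
          (α ω (k * blockLen m N i) i) +
      (N : ℝ) ^ m * (K * Real.log (N + K) / √N) := by
  have hBn := blockLen_pos hN i
  set B := blockLen m N i with hB
  have hBr : (0 : ℝ) < B := Nat.cast_pos.2 hBn
  have hNr : (0 : ℝ) < N := Nat.cast_pos.2 hN
  have hs : 0 < √(N : ℝ) := Real.sqrt_pos.2 hNr
  have hss : √(N : ℝ) * √N = N := Real.mul_self_sqrt hNr.le
  have hK : 0 < K := i.pos.trans_le h
  have hKr : (0 : ℝ) < K := Nat.cast_pos.2 hK
  have hκ : (K : ℝ) / (N * (K / √N)) = 1 / √N := by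
    field_simp
    rw [Real.sq_sqrt hNr.le]
  have hsteps : (K : ℝ) / (N * (K / √N)) ≤ 1 := by
    rw [hκ, div_le_one hs]
    exact Real.one_le_sqrt.2 (by exact_mod_cast hN)
  have key := Learner.sum_state_gain_le (N := N) hq hsteps (N ^ (i : ℕ))
    (fun k => α ω (k * B) i) (avgGain N l (α ω) i) (fun k => hα.mem ω _ i)
    (avgGain_nonneg hl i) (avgGain_le_one i)
    (fun ι s => comparator h S (α ω (ι * N * B)) i s)
    (fun ι _ s => comparator_mem_allowed h S _ i s)
  have hpow : ((N ^ (i : ℕ) * N : ℕ) : ℝ) * B = (N : ℝ) ^ m := by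
    exact_mod_cast pow_mul_blockLen N i
  -- The rounds from `T` to `N ^ m` complete the last blocks. They contribute nothing, since the
  -- losses there are `1`.
  have hext : ∀ f : ℕ → ℝ, (∀ t, T ≤ t → f t = 0) → ∑ k ∈ Finset.range (N ^ (i : ℕ) * N),
      ∑ r ∈ Finset.range B, f (k * B + r) = ∑ t ∈ Finset.range T, f t := by
    intro f hf
    rw [← sum_range_mul_eq, pow_mul_blockLen]
    refine (Finset.sum_subset (Finset.range_mono hT) fun t _ ht => hf t ?_).symm
    simpa using ht
  have hx0 : ∀ t, T ≤ t → 1 - sufferedLoss (l t) (α ω t) i = 0 := fun t ht => by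
    have h1 := le_sufferedLoss (l := l t) (a := α ω t) i
    rw [hlT t _ ht] at h1
    linarith [sufferedLoss_le_one (hl t) i (a := α ω t)]
  have hgB : ∀ k, (B : ℝ) * avgGain N l (α ω) i k =
      ∑ r ∈ Finset.range B, (1 - sufferedLoss (l (k * B + r)) (α ω (k * B + r)) i) := fun k =>
    mul_div_cancel₀ _ hBr.ne'
  have hL : (B : ℝ) * ∑ k ∈ Finset.range (N ^ (i : ℕ) * N), ∑ s, (learner h N i).inc
      ((learner h N i).state N (fun k => α ω (k * B) i) (avgGain N l (α ω) i) k)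
      (α ω (k * B) i) (avgGain N l (α ω) i k) s (comparator h S (α ω (k / N * N * B)) i s) =
      ∑ t ∈ Finset.range T, estWeight N l h S i (t / B) (α ω (t / B * B) i) (α ω) *
        (1 - sufferedLoss (l t) (α ω t) i) := by
    rw [← hext _ (fun t ht => by rw [hx0 t ht, mul_zero]), Finset.mul_sum]
    refine Finset.sum_congr rfl fun k _ => ?_
    have h1 := sum_inc_eq (N := N) (l := l) (α := α ω) h (S := S) i k (α ω (k * B) i)
      (avgGain N l (α ω) i k)
    refine (congrArg ((B : ℝ) * ·) h1).trans ?_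
    rw [mul_left_comm, hgB, Finset.mul_sum]
    refine Finset.sum_congr rfl fun r hr => ?_
    have : (k * B + r) / B = k := by
      rw [mul_comm, Nat.mul_add_div hBn, Nat.div_eq_of_lt (Finset.mem_range.1 hr), add_zero]
    rw [this]
  have hG : (B : ℝ) * ∑ k ∈ Finset.range (N ^ (i : ℕ) * N), avgGain N l (α ω) i k =
      ∑ t ∈ Finset.range T, (1 - sufferedLoss (l t) (α ω t) i) := by
    rw [← hext _ hx0, Finset.mul_sum]
    exact Finset.sum_congr rfl fun k _ => hgB k
  have key' := mul_le_mul_of_nonneg_left key hBr.le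
  refine (hL.symm.trans_le key').trans ?_
  have hlog : Real.log (1 + K * (1 / N)) - Real.log (1 / N) = Real.log (N + K) := by
    rw [← Real.log_div (by positivity) (by positivity)]
    congr 1
    field_simp
  rw [Finset.sum_add_distrib, Finset.sum_add_distrib, Finset.sum_const, Finset.card_range,
    nsmul_eq_mul, ← Finset.mul_sum]
  change (B : ℝ) * (_ + ((N ^ (i : ℕ) * N : ℕ) : ℝ) * (2 * (K / √N) + K / (N * (K / √N))) +
    3 * (1 / √N) * _ + ((N ^ (i : ℕ) : ℕ) : ℝ) *
      (K * (Real.log (1 + K * (1 / N)) - Real.log (1 / N)) / (1 / √N))) ≤ _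
  rw [hκ, hlog]
  have h3 : (B : ℝ) * (((N ^ (i : ℕ) : ℕ) : ℝ) * (K * Real.log (N + K) / (1 / √N))) =
      (N : ℝ) ^ m * (K * Real.log (N + K) / √N) := by
    have h4 : K * Real.log (N + K) / (1 / √(N : ℝ)) = N * (K * Real.log (N + K) / √N) := by
      rw [div_div_eq_mul_div, div_one, mul_div_assoc', eq_div_iff hs.ne', mul_assoc, hss,
        mul_comm]
    rw [← hpow, h4]
    push_cast
    ring
  rw [mul_add, mul_add, mul_add, hG, h3, ← mul_assoc (B : ℝ) _ (_ + _), mul_comm (B : ℝ), hpow]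
  gcongr ?_ + ?_ + ?_ + ?_
  · exact le_rfl
  · exact le_rfl
  · refine le_of_eq ?_
    rw [← mul_assoc, mul_comm (B : ℝ)]
    rfl
  · exact le_rfl

variable [IsProbabilityMeasure μ]

/-- The variance term: the mean of `1 / dist` at an arm drawn from `dist` is the number of arms of
positive probability, at most `K`. -/
theorem IsLearnerProcess.integral_gain_div_dist_le (hα : IsLearnerProcess μ h N T l α)
    (i : Fin m) (hq : (learner h N i).Valid) (hl : ∀ t b, l t b ∈ Set.Icc (0 : ℝ) 1)
    (hlT : ∀ t b, T ≤ t → l t b = 1) (k : ℕ) :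
    ∫ ω, avgGain N l (α ω) i k / (learner h N i).dist (pathState h N l i k (α ω))
          (α ω (k * blockLen m N i) i) ∂μ ≤ K := by
  by_cases hk : k * blockLen m N i < T
  · calc _ ≤ ∫ ω, 1 / (learner h N i).dist (pathState h N l i k (α ω))
          (α ω (k * blockLen m N i) i) ∂μ := by
          refine integral_mono (hα.integrable fun β => avgGain N l β i k /
            (learner h N i).dist (pathState h N l i k β) (β (k * blockLen m N i) i))
            (hα.integrable fun β => 1 / (learner h N i).dist (pathState h N l i k β)
              (β (k * blockLen m N i) i)) fun ω => ?_
          exact div_le_div_of_nonneg_right (avgGain_le_one i k) (Learner.dist_nonneg _ hq _)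
      _ = ∫ ω, ∑ b, (learner h N i).dist (pathState h N l i k (α ω)) b *
          (1 / (learner h N i).dist (pathState h N l i k (α ω)) b) ∂μ := by
          refine hα.sample i k hk
            (fun b β => 1 / (learner h N i).dist (pathState h N l i k β) b) fun b β β' hs _ => ?_
          have hN : 0 < N := hq.steps_pos
          rw [pathState_congr h hN i k hs]
      _ ≤ ∫ _, (K : ℝ) ∂μ := by
          refine integral_mono (hα.integrable fun β => ∑ b, (learner h N i).dist
            (pathState h N l i k β) b * (1 / (learner h N i).dist (pathState h N l i k β) b))
            (integrable_const _) fun ω => ?_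
          refine (Finset.sum_le_card_nsmul _ _ 1 fun b _ => ?_).trans (by simp)
          rw [mul_one_div]
          exact div_self_le_one _
      _ = K := by simp
  · have h0 : ∀ ω, avgGain N l (α ω) i k = 0 := by
      intro ω
      rw [avgGain, Finset.sum_eq_zero, zero_div]
      intro r _
      have h1 := le_sufferedLoss (l := l (k * blockLen m N i + r))
        (a := α ω (k * blockLen m N i + r)) i
      rw [hlT _ _ (by omega)] at h1
      linarith [sufferedLoss_le_one (hl (k * blockLen m N i + r)) i
        (a := α ω (k * blockLen m N i + r))]
    simp [h0]

/-- The expected regret of player `i` against her comparison arms. -/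
theorem IsLearnerProcess.integral_sufferedLoss_le (hα : IsLearnerProcess μ h N T l α)
    (i : Fin m) (hN : 4 * K ^ 2 ≤ N) (hl : ∀ t b, l t b ∈ Set.Icc (0 : ℝ) 1)
    (hlT : ∀ t b, T ≤ t → l t b = 1) (hT : T ≤ N ^ m) {S : Finset (Fin K)} (hS : S.card = m) :
    ∫ ω, ∑ t ∈ Finset.range T, sufferedLoss (l t) (α ω t) i ∂μ ≤
      ∫ ω, ∑ t ∈ Finset.range T, l t (comparator h S (α ω t) i (α ω t i)) ∂μ +
        (N : ℝ) ^ m * (K * (9 + Real.log (N + K)) / √N) := by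
  have hq := learner_valid h hN
  have hN0 : 0 < N := (hq i).steps_pos
  have hNr : (0 : ℝ) < N := Nat.cast_pos.2 hN0
  have hs : 0 < √(N : ℝ) := Real.sqrt_pos.2 hNr
  have hmK : (m : ℝ) ≤ K := Nat.cast_le.2 h
  have hK1 : (1 : ℝ) ≤ K := by exact_mod_cast i.pos.trans_le h
  set W := fun (t : ℕ) (β : ℕ → Fin m → Fin K) =>
    estWeight N l h S i (t / blockLen m N i) (β (t / blockLen m N i * blockLen m N i) i) β *
      (1 - sufferedLoss (l t) (β t) i) with hW
  set D := fun (k : ℕ) (β : ℕ → Fin m → Fin K) =>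
    avgGain N l β i k / (learner h N i).dist (pathState h N l i k β)
      (β (k * blockLen m N i) i) with hD
  set c1 := (N : ℝ) ^ m * (2 * (K / √N) + 1 / √N) with hc1
  set c2 := 3 * (1 / √(N : ℝ)) * blockLen m N i with hc2
  set c3 := (N : ℝ) ^ m * (K * Real.log (N + K) / √N) with hc3
  have h1 : ∫ ω, ∑ t ∈ Finset.range T, W t (α ω) ∂μ ≤
      ∫ ω, (∑ t ∈ Finset.range T, (1 - sufferedLoss (l t) (α ω t) i) + c1 +
        c2 * ∑ k ∈ Finset.range (N ^ (i : ℕ) * N), D k (α ω) + c3) ∂μ :=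
    integral_mono (hα.integrable fun β => ∑ t ∈ Finset.range T, W t β)
      (hα.integrable fun β => ∑ t ∈ Finset.range T, (1 - sufferedLoss (l t) (β t) i) + c1 +
        c2 * ∑ k ∈ Finset.range (N ^ (i : ℕ) * N), D k β + c3)
      fun ω => hα.sum_estWeight_le i hN0 (hq i) hl hlT hT S ω
  have hiD : ∀ k ∈ Finset.range (N ^ (i : ℕ) * N), Integrable (fun ω => D k (α ω)) μ :=
    fun k _ => hα.integrable (D k)
  have hiX : Integrable
      (fun ω => ∑ t ∈ Finset.range T, (1 - sufferedLoss (l t) (α ω t) i)) μ :=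
    hα.integrable fun β => ∑ t ∈ Finset.range T, (1 - sufferedLoss (l t) (β t) i)
  have hiX' : ∀ t ∈ Finset.range T, Integrable (fun ω => sufferedLoss (l t) (α ω t) i) μ :=
    fun t _ => hα.integrable fun β => sufferedLoss (l t) (β t) i
  have hiC : ∀ t ∈ Finset.range T,
      Integrable (fun ω => l t (comparator h S (α ω t) i (α ω t i))) μ :=
    fun t _ => hα.integrable fun β => l t (comparator h S (β t) i (β t i))
  have hiSD : Integrable (fun ω => c2 * ∑ k ∈ Finset.range (N ^ (i : ℕ) * N), D k (α ω)) μ :=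
    (integrable_finsetSum _ hiD).const_mul c2
  have hiX1 : Integrable
      (fun ω => ∑ t ∈ Finset.range T, (1 - sufferedLoss (l t) (α ω t) i) + c1) μ :=
    hiX.add (integrable_const _)
  have hiX2 : Integrable (fun ω => ∑ t ∈ Finset.range T, (1 - sufferedLoss (l t) (α ω t) i) + c1 +
      c2 * ∑ k ∈ Finset.range (N ^ (i : ℕ) * N), D k (α ω)) μ := hiX1.add hiSD
  have hiW : ∀ t ∈ Finset.range T, Integrable (fun ω => W t (α ω)) μ :=
    fun t _ => hα.integrable (W t)
  have hiG : ∀ t ∈ Finset.range T, Integrable (fun ω => 1 - sufferedLoss (l t) (α ω t) i) μ :=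
    fun t ht => (integrable_const (1 : ℝ)).sub (hiX' t ht)
  rw [integral_add hiX2 (integrable_const _), integral_add hiX1 hiSD,
    integral_add hiX (integrable_const _), integral_const_mul c2, integral_finsetSum _ hiD,
    integral_finsetSum _ hiW, integral_finsetSum _ hiG] at h1
  simp only [integral_const, probReal_univ, one_smul] at h1
  have h2 : ∑ k ∈ Finset.range (N ^ (i : ℕ) * N), ∫ ω, D k (α ω) ∂μ ≤
      ((N ^ (i : ℕ) * N : ℕ) : ℝ) * K := by
    refine (Finset.sum_le_card_nsmul _ _ _ fun k _ =>
      hα.integral_gain_div_dist_le i (hq i) hl hlT k).trans (by simp)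
  have h3 : c2 * ∑ k ∈ Finset.range (N ^ (i : ℕ) * N), ∫ ω, D k (α ω) ∂μ ≤
      (N : ℝ) ^ m * (3 * K / √N) := by
    refine (mul_le_mul_of_nonneg_left h2 (by positivity)).trans_eq ?_
    have hpow : ((N ^ (i : ℕ) * N : ℕ) : ℝ) * blockLen m N i = (N : ℝ) ^ m := by
      exact_mod_cast pow_mul_blockLen N i
    rw [← hpow, hc2]
    ring
  set c4 := (K : ℝ) / √N + m * (1 / N + 1 / √N) with hc4
  have h4 : ∑ t ∈ Finset.range T, ∫ ω, (1 - l t (comparator h S (α ω t) i (α ω t i))) ∂μ ≤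
      ∑ t ∈ Finset.range T, ∫ ω, W t (α ω) ∂μ + T * c4 := by
    have : (T : ℝ) * c4 = ∑ t ∈ Finset.range T, c4 := by simp
    rw [this, ← Finset.sum_add_distrib]
    exact Finset.sum_le_sum fun t ht =>
      hα.integral_comparator_gain_le i hN0 hq hl hS (Finset.mem_range.1 ht)
  have h5 : (T : ℝ) * c4 ≤ (N : ℝ) ^ m * (3 * (K / √N)) := by
    have hTN : (T : ℝ) ≤ (N : ℝ) ^ m := by exact_mod_cast hT
    have h6 : (1 : ℝ) / N ≤ 1 / √N := by
      refine one_div_le_one_div_of_le hs ?_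
      refine (Real.sqrt_le_left hNr.le).2 ?_
      have : (1 : ℝ) ≤ N := by exact_mod_cast hN0
      nlinarith
    have h7 : m * (1 / N + 1 / √(N : ℝ)) ≤ K * (1 / √(N : ℝ) + 1 / √N) := by gcongr
    have h8 : c4 ≤ 3 * (K / √N) := by
      rw [hc4]
      refine (add_le_add_right h7 _).trans_eq ?_
      ring
    have h9 : 0 ≤ c4 := by positivity
    exact mul_le_mul hTN h8 h9 (by positivity)
  have h6 : c1 ≤ (N : ℝ) ^ m * (3 * (K / √N)) := by
    have : (1 : ℝ) / √N ≤ K / √N := by gcongr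
    rw [hc1]
    gcongr
    linarith
  rw [integral_finsetSum _ hiX', integral_finsetSum _ hiC]
  have h7 : ∀ t ∈ Finset.range T, ∫ ω, (1 - l t (comparator h S (α ω t) i (α ω t i))) ∂μ =
      1 - ∫ ω, l t (comparator h S (α ω t) i (α ω t i)) ∂μ := fun t ht => by
    rw [integral_sub (integrable_const _) (hiC t ht)]; simp
  have h8 : ∀ t ∈ Finset.range T, ∫ ω, (1 - sufferedLoss (l t) (α ω t) i) ∂μ =
      1 - ∫ ω, sufferedLoss (l t) (α ω t) i ∂μ := fun t ht => by
    rw [integral_sub (integrable_const _) (hiX' t ht)]; simp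
  rw [Finset.sum_congr rfl h7, Finset.sum_sub_distrib] at h4
  rw [Finset.sum_congr rfl h8, Finset.sum_sub_distrib] at h1
  -- The `9` is `3 + 3 + 3`: exploration and approximate stationarity (`c1`), comparison with the
  -- estimates including collisions (`c4`), and the variance term. The logarithm comes from the
  -- prior weights (`c3`).
  have h9 : (N : ℝ) ^ m * (K * (9 + Real.log (N + K)) / √N) =
      (N : ℝ) ^ m * (3 * (K / √N)) + (N : ℝ) ^ m * (3 * (K / √N)) +
        (N : ℝ) ^ m * (3 * K / √N) + c3 := by rw [hc3]; ring
  rw [h9]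
  linarith

/-- The expected regret of all players. -/
theorem IsLearnerProcess.integral_regret_le (hα : IsLearnerProcess μ h N T l α)
    (hN : 4 * K ^ 2 ≤ N) (hl : ∀ t b, l t b ∈ Set.Icc (0 : ℝ) 1)
    (hlT : ∀ t b, T ≤ t → l t b = 1) (hT : T ≤ N ^ m) {S : Finset (Fin K)} (hS : S.card = m) :
    ∫ ω, ∑ t ∈ Finset.range T, (∑ i, sufferedLoss (l t) (α ω t) i - ∑ a ∈ S, l t a) ∂μ ≤
      m * ((N : ℝ) ^ m * (K * (9 + Real.log (N + K)) / √N)) := by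
  have h1 : ∀ ω, ∑ t ∈ Finset.range T, (∑ i, sufferedLoss (l t) (α ω t) i - ∑ a ∈ S, l t a) =
      ∑ i, (∑ t ∈ Finset.range T, sufferedLoss (l t) (α ω t) i -
        ∑ t ∈ Finset.range T, l t (comparator h S (α ω t) i (α ω t i))) := by
    intro ω
    rw [Finset.sum_sub_distrib, Finset.sum_sub_distrib, Finset.sum_comm]
    congr 1
    rw [Finset.sum_comm (s := Finset.univ)]
    exact Finset.sum_congr rfl fun t _ => (sum_comparator h hS (l t)).symm
  have hiX : ∀ i, Integrable (fun ω => ∑ t ∈ Finset.range T, sufferedLoss (l t) (α ω t) i) μ :=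
    fun i => hα.integrable fun β => ∑ t ∈ Finset.range T, sufferedLoss (l t) (β t) i
  have hiC : ∀ i, Integrable
      (fun ω => ∑ t ∈ Finset.range T, l t (comparator h S (α ω t) i (α ω t i))) μ :=
    fun i => hα.integrable fun β => ∑ t ∈ Finset.range T, l t (comparator h S (β t) i (β t i))
  simp_rw [h1]
  have hi : ∀ i ∈ Finset.univ, Integrable (fun ω =>
      ∑ t ∈ Finset.range T, sufferedLoss (l t) (α ω t) i -
        ∑ t ∈ Finset.range T, l t (comparator h S (α ω t) i (α ω t i))) μ :=
    fun i _ => (hiX i).sub (hiC i)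
  rw [integral_finsetSum _ hi]
  refine (Finset.sum_le_card_nsmul _ _
    ((N : ℝ) ^ m * (K * (9 + Real.log (N + K)) / √N)) fun i _ => ?_).trans_eq (by simp)
  rw [integral_sub (hiX i) (hiC i), sub_le_iff_le_add']
  exact hα.integral_sufferedLoss_le i hN hl hlT hT hS

end PlayerRegret

end MultiBandit

/-! ### Sampling an arm from a uniform seed, and resampling one seed -/

namespace MultiBandit

section Sampling

variable {K : ℕ}

/-- The indices of the intervals, of lengths `p`, that contain `u`. -/
noncomputable def hitArms (p : Fin K → ℝ) (u : unitInterval) : Finset (Fin K) :=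
  Finset.univ.filter fun a =>
    ∑ b ∈ Finset.Iio a, p b ≤ (u : ℝ) ∧ (u : ℝ) < ∑ b ∈ Finset.Iio a, p b + p a

/-- An arm with distribution `p`, when `u` is uniformly distributed; `d` is a default value. -/
noncomputable def sampleArm (d : Fin K) (p : Fin K → ℝ) (u : unitInterval) : Fin K :=
  if hu : (hitArms p u).Nonempty then (hitArms p u).min' hu else d

theorem sampleArm_eq_or (d : Fin K) (p : Fin K → ℝ) (u : unitInterval) :
    sampleArm d p u = d ∨ 0 < p (sampleArm d p u) := by
  unfold sampleArm
  split_ifs with hu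
  · right
    have := (Finset.mem_filter.1 (Finset.min'_mem _ hu)).2
    linarith [this.1, this.2]
  · exact Or.inl rfl

theorem sampleArm_eq {d : Fin K} {p : Fin K → ℝ} (hp : ∀ a, 0 ≤ p a) {u : unitInterval}
    {a : Fin K} (ha : a ∈ hitArms p u) : sampleArm d p u = a := by
  have hlt : ∀ b c : Fin K, b < c → b ∈ hitArms p u → c ∉ hitArms p u := by
    intro b c hbc hb hc
    have hb := (Finset.mem_filter.1 hb).2.2
    have hc := (Finset.mem_filter.1 hc).2.1
    have hsub : insert b (Finset.Iio b) ⊆ Finset.Iio c := by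
      intro x hx
      rcases Finset.mem_insert.1 hx with rfl | hx
      · exact Finset.mem_Iio.2 hbc
      · exact Finset.mem_Iio.2 ((Finset.mem_Iio.1 hx).trans hbc)
    have := Finset.sum_le_sum_of_subset_of_nonneg (f := p) hsub fun x _ _ => hp x
    rw [Finset.sum_insert (by simp)] at this
    linarith
  have hu : (hitArms p u).Nonempty := ⟨a, ha⟩
  rw [sampleArm, dif_pos hu]
  rcases lt_trichotomy ((hitArms p u).min' hu) a with h | h | h
  · exact absurd ha (hlt _ _ h (Finset.min'_mem _ hu))
  · exact h
  · exact absurd (Finset.min'_mem _ hu) (hlt _ _ h ha)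

theorem measurable_sampleArm (d : Fin K) :
    Measurable fun x : (Fin K → ℝ) × unitInterval => sampleArm d x.1 x.2 := by
  have h1 : ∀ a, MeasurableSet {x : (Fin K → ℝ) × unitInterval | a ∈ hitArms x.1 x.2} := by
    intro a
    simp only [hitArms, Finset.mem_filter, Finset.mem_univ, true_and]
    have hs : Measurable fun x : (Fin K → ℝ) × unitInterval => ∑ b ∈ Finset.Iio a, x.1 b := by
      fun_prop
    have hu : Measurable fun x : (Fin K → ℝ) × unitInterval => (x.2 : ℝ) := by fun_prop
    have ha : Measurable fun x : (Fin K → ℝ) × unitInterval => x.1 a := by fun_prop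
    exact (measurableSet_le hs hu).inter (measurableSet_lt hu (hs.add ha))
  have h2 : Measurable fun x : (Fin K → ℝ) × unitInterval => hitArms x.1 x.2 := by
    refine measurable_to_countable' fun s => ?_
    have : (fun x : (Fin K → ℝ) × unitInterval => hitArms x.1 x.2) ⁻¹' {s} =
        ⋂ a, {x | a ∈ hitArms x.1 x.2 ↔ a ∈ s} := by
      ext x
      simp [Finset.ext_iff]
    rw [this]
    refine MeasurableSet.iInter fun a => ?_
    by_cases ha : a ∈ s
    · simpa [ha] using h1 a
    · simp only [ha, iff_false]
      exact (h1 a).compl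
  have h3 : Measurable fun s : Finset (Fin K) => if hs : s.Nonempty then s.min' hs else d :=
    Measurable.of_discrete
  exact h3.comp h2

/-- A half-open interval of length `p a` is sent to `a`, so the law of the sample dominates `p`.
Both have total mass `1`, hence they agree, and the default value needs no separate treatment. -/
theorem integral_sampleArm (d : Fin K) {p : Fin K → ℝ} (hp : ∀ a, 0 ≤ p a) (hp1 : ∑ a, p a = 1)
    (f : Fin K → ℝ) : ∫ u, f (sampleArm d p u) = ∑ a, p a * f a := by
  have hm : Measurable fun u => sampleArm d p u := by
    have h := (measurable_sampleArm d).comp (measurable_prodMk_left (x := p))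
    simpa only [Function.comp_def] using h
  have hprob := Measure.isProbabilityMeasure_map (μ := (volume : Measure unitInterval))
    hm.aemeasurable
  have hle : ∀ a, p a ≤ (Measure.map (sampleArm d p) volume).real {a} := by
    intro a
    rw [map_measureReal_apply hm (measurableSet_singleton a)]
    have h0 : 0 ≤ ∑ b ∈ Finset.Iio a, p b := Finset.sum_nonneg fun b _ => hp b
    have h1 : ∑ b ∈ Finset.Iio a, p b + p a ≤ 1 := by
      rw [← hp1, add_comm, ← Finset.sum_insert (by simp)]
      exact Finset.sum_le_sum_of_subset_of_nonneg (Finset.subset_univ _) fun x _ _ => hp x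
    let x : unitInterval := ⟨_, h0, by linarith [hp a]⟩
    let y : unitInterval := ⟨_, by linarith [hp a], h1⟩
    have hsub : Set.Ico x y ⊆ sampleArm d p ⁻¹' {a} := by
      intro u hu
      exact sampleArm_eq hp (Finset.mem_filter.2 ⟨Finset.mem_univ _, hu.1, hu.2⟩)
    have hv : (volume : Measure unitInterval).real (Set.Ico x y) = p a := by
      rw [Measure.real, unitInterval.volume_Ico, ENNReal.toReal_ofReal] <;> simp [x, y, hp a]
    rw [← hv]
    exact measureReal_mono hsub
  have hsum : ∑ a, (Measure.map (sampleArm d p) volume).real {a} = 1 := by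
    simp
  have heq : ∀ a ∈ Finset.univ, p a = (Measure.map (sampleArm d p) volume).real {a} :=
    (Finset.sum_eq_sum_iff_of_le fun a _ => hle a).1 (hp1.trans hsum.symm)
  rw [← integral_map hm.aemeasurable (Measurable.of_discrete.aestronglyMeasurable),
    integral_fintype (Integrable.of_finite)]
  refine Finset.sum_congr rfl fun a ha => ?_
  rw [← heq a ha, smul_eq_mul]

end Sampling

section Resampling

variable {ι : Type*} [Fintype ι] [DecidableEq ι]

/-- Resampling one coordinate preserves a product of probability measures. -/
theorem measurePreserving_update {X : ι → Type*} [∀ i, MeasurableSpace (X i)]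
    (μ : ∀ i, Measure (X i)) [∀ i, IsProbabilityMeasure (μ i)] (i : ι) :
    MeasurePreserving (fun p : (∀ j, X j) × X i => Function.update p.1 i p.2)
      ((Measure.pi μ).prod (μ i)) (Measure.pi μ) := by
  refine ⟨measurable_update', (Measure.pi_eq fun s hs => ?_).symm⟩
  rw [Measure.map_apply measurable_update' (MeasurableSet.univ_pi hs)]
  have : (fun p : (∀ j, X j) × X i => Function.update p.1 i p.2) ⁻¹' Set.univ.pi s =
      (Set.univ.pi (Function.update s i Set.univ)) ×ˢ s i := by
    ext p
    simp only [Set.mem_preimage, Set.mem_univ_pi, Set.mem_prod]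
    constructor
    · intro h
      refine ⟨fun j => ?_, by simpa using h i⟩
      by_cases hj : j = i
      · subst hj; simp
      · simpa [hj] using h j
    · rintro ⟨h1, h2⟩ j
      by_cases hj : j = i
      · subst hj; simpa using h2
      · simpa [hj] using h1 j
  rw [this, Measure.prod_prod, Measure.pi_pi]
  rw [← Finset.mul_prod_erase _ _ (Finset.mem_univ i),
    ← Finset.mul_prod_erase Finset.univ (fun j => μ j (s j)) (Finset.mem_univ i)]
  simp only [Function.update_self, measure_univ, one_mul]
  rw [mul_comm]
  congr 1
  refine Finset.prod_congr rfl fun j hj => ?_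
  rw [Function.update_of_ne (Finset.ne_of_mem_erase hj)]

variable {κ : Type*} [Fintype κ] [DecidableEq κ] {X : Type*} [MeasurableSpace X]

theorem measurePreserving_update_update (ν : Measure X) [IsProbabilityMeasure ν] (t : ι) (i : κ) :
    MeasurePreserving
      (fun p : (ι → κ → X) × X => Function.update p.1 t (Function.update (p.1 t) i p.2))
      ((Measure.pi fun _ : ι => Measure.pi fun _ : κ => ν).prod ν)
      (Measure.pi fun _ : ι => Measure.pi fun _ : κ => ν) := by
  have h1 := measurePreserving_update (fun _ : ι => Measure.pi fun _ : κ => ν) t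
  have h2 := measurePreserving_update (fun _ : κ => ν) i
  have hm : Measurable
      (fun p : (ι → κ → X) × X => Function.update p.1 t (Function.update (p.1 t) i p.2)) := by
    have h3 : Measurable fun p : (ι → κ → X) × X =>
        (p.1, Function.update (p.1 t) i p.2) := by
      refine measurable_fst.prodMk ?_
      have h4 : Measurable fun p : (ι → κ → X) × X => (p.1 t, p.2) := by fun_prop
      exact (measurable_update' (X := fun _ : κ => X) (a := i)).comp h4
    exact measurable_update'.comp h3
  -- Take a fresh independent round `r`. Replacing round `t` by `r` and then entry `i` by `x` is the
  -- same as replacing round `t` by `r` with its entry `i` already replaced. The first description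
  -- is the map in question after `h5`, the second is `h4`.
  have h4 := h1.comp (((MeasurePreserving.id
    (Measure.pi fun _ : ι => Measure.pi fun _ : κ => ν)).prod h2).comp
      (measurePreserving_prodAssoc _ _ ν))
  have h5 := h1.prod (MeasurePreserving.id ν)
  refine ⟨hm, ?_⟩
  rw [← h5.map_eq, Measure.map_map hm h5.measurable]
  refine Eq.trans ?_ h4.map_eq
  congr 1
  funext p
  simp [Prod.map, MeasurableEquiv.prodAssoc]

end Resampling

end MultiBandit

/-! ### The strategies, and the law of the path that they generate -/

namespace MultiBandit

namespace Learner

variable {K : ℕ}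

/-- The estimated gains, when the arms are sampled with the seeds `u` and give the gains `g`. -/
noncomputable def seedState (q : Learner K) (N : ℕ) (u : ℕ → unitInterval) (g : ℕ → ℝ) :
    ℕ → Fin K → Fin K → ℝ
  | 0 => 0
  | k + 1 => if N ∣ k + 1 then 0 else seedState q N u g k +
      q.inc (seedState q N u g k) (sampleArm q.home (q.dist (seedState q N u g k)) (u k)) (g k)

/-- The arm that the learner plays in round `t`, when she keeps her arms for `B` rounds, her seeds
are `u` and her suffered losses are `x`. -/
noncomputable def roundArm (q : Learner K) (N B : ℕ) (u : ℕ → unitInterval) (x : ℕ → ℝ) (t : ℕ) :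
    Fin K :=
  sampleArm q.home (q.dist (q.seedState N (fun k => u (k * B))
    (fun k => (∑ r ∈ Finset.range B, (1 - x (k * B + r))) / B) (t / B))) (u (t / B * B))

variable {q : Learner K} {N : ℕ}

theorem seedState_congr {u u' : ℕ → unitInterval} {g g' : ℕ → ℝ} {n : ℕ}
    (hu : ∀ k < n, u k = u' k) (hg : ∀ k < n, g k = g' k) :
    q.seedState N u g n = q.seedState N u' g' n := by
  induction n with
  | zero => rfl
  | succ n ih =>
    simp only [seedState]
    rw [ih (fun k hk => hu k (by omega)) (fun k hk => hg k (by omega)), hu n (by omega),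
      hg n (by omega)]

/-- A player's past arms are not among her inputs. She recomputes them from her seeds, whereas the
analysis treats them as given. -/
theorem seedState_eq_state {u : ℕ → unitInterval} {g : ℕ → ℝ} {A : ℕ → Fin K} {n : ℕ}
    (hA : ∀ k < n, A k = sampleArm q.home (q.dist (q.seedState N u g k)) (u k)) :
    q.seedState N u g n = q.state N A g n := by
  induction n with
  | zero => rfl
  | succ n ih =>
    simp only [seedState, state]
    rw [← ih fun k hk => hA k (by omega), hA n (by omega)]

/-- Causality: a new arm uses the losses of completed sub-blocks only, and the seed of the first
round of the current one. -/
theorem roundArm_congr {B : ℕ} (hB : 0 < B) {u u' : ℕ → unitInterval} {x x' : ℕ → ℝ} {t : ℕ}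
    (hu : ∀ s ≤ t, u s = u' s) (hx : ∀ s < t, x s = x' s) :
    q.roundArm N B u x t = q.roundArm N B u' x' t := by
  have hle : t / B * B ≤ t := Nat.div_mul_le_self t B
  have hlt : ∀ k < t / B, k * B + B ≤ t := fun k hk => by
    have := Nat.mul_le_mul_right B (Nat.succ_le_of_lt hk)
    rw [Nat.succ_mul] at this
    omega
  unfold roundArm
  rw [hu _ hle, seedState_congr (u' := fun k => u' (k * B))
    (g' := fun k => (∑ r ∈ Finset.range B, (1 - x' (k * B + r))) / B)]
  · intro k hk
    exact hu _ (by have := hlt k hk; omega)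
  · intro k hk
    congr 1
    refine Finset.sum_congr rfl fun r hr => ?_
    rw [hx _ (by have := hlt k hk; have := Finset.mem_range.1 hr; omega)]

theorem roundArm_mul {B : ℕ} (hB : 0 < B) (u : ℕ → unitInterval) (x : ℕ → ℝ) (t : ℕ) :
    q.roundArm N B u x (t / B * B) = q.roundArm N B u x t := by
  unfold roundArm
  rw [Nat.mul_div_cancel _ hB]

theorem sampleArm_mem (hq : q.Valid) (L : Fin K → Fin K → ℝ) (u : unitInterval) :
    sampleArm q.home (q.dist L) u ∈ q.arms := by
  rcases sampleArm_eq_or q.home (q.dist L) u with h | h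
  · rw [h]; exact hq.home_mem
  · by_contra hn
    rw [dist_eq_zero L hq hn] at h
    exact lt_irrefl _ h

theorem measurable_potential (s : Fin K) :
    Measurable fun L : Fin K → Fin K → ℝ => q.potential L s := by
  unfold potential; fun_prop

theorem measurable_row (s a : Fin K) :
    Measurable fun L : Fin K → Fin K → ℝ => q.row L s a := by
  have := measurable_potential (q := q) s
  unfold row; fun_prop

theorem measurable_occ (k : ℕ) (a : Fin K) :
    Measurable fun L : Fin K → Fin K → ℝ => q.occ L k a := by
  induction k generalizing a with
  | zero => exact measurable_const
  | succ k ih => exact Finset.measurable_sum _ fun s _ => (ih s).mul (measurable_row s a)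

theorem measurable_base (a : Fin K) : Measurable fun L : Fin K → Fin K → ℝ => q.base L a :=
  (Finset.measurable_sum _ fun k _ => measurable_occ k a).div_const _

theorem measurable_dist : Measurable fun L : Fin K → Fin K → ℝ => q.dist L :=
  measurable_pi_lambda _ fun a => ((measurable_base a).const_mul _).add_const _

theorem measurable_inc {X : Type*} [MeasurableSpace X] {L : X → Fin K → Fin K → ℝ}
    {A : X → Fin K} {g : X → ℝ} (hL : Measurable L) (hA : Measurable A) (hg : Measurable g) :
    Measurable fun x => q.inc (L x) (A x) (g x) := by
  refine measurable_pi_lambda _ fun s => measurable_pi_lambda _ fun b => ?_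
  -- The entry vanishes unless the arm is `b`, so `dist` may be evaluated at the fixed index `b`.
  have : (fun x => q.inc (L x) (A x) (g x) s b) =
      fun x => if A x = b then q.base (L x) s * g x / q.dist (L x) b else 0 := by
    funext x
    unfold inc
    by_cases h : A x = b
    · simp [h]
    · simp [h, Ne.symm h]
  rw [this]
  refine Measurable.ite (hA (measurableSet_singleton b)) ?_ measurable_const
  exact (((measurable_base s).comp hL).mul hg).div
    ((measurable_pi_apply b).comp (measurable_dist.comp hL))

theorem measurable_sampleArm_dist {X : Type*} [MeasurableSpace X] {L : X → Fin K → Fin K → ℝ}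
    {u : X → unitInterval} (hL : Measurable L) (hu : Measurable u) :
    Measurable fun x => sampleArm q.home (q.dist (L x)) (u x) := by
  have h := (measurable_sampleArm q.home).comp ((measurable_dist (q := q).comp hL).prodMk hu)
  simpa only [Function.comp_def] using h

theorem measurable_seedState {X : Type*} [MeasurableSpace X] {u : X → ℕ → unitInterval}
    {g : X → ℕ → ℝ} (hu : Measurable u) (hg : Measurable g) (n : ℕ) :
    Measurable fun x => q.seedState N (u x) (g x) n := by
  induction n with
  | zero => exact measurable_const
  | succ n ih =>
    simp only [seedState]
    split_ifs
    · exact measurable_const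
    · exact ih.add (measurable_inc ih
        (measurable_sampleArm_dist ih ((measurable_pi_apply n).comp hu))
        ((measurable_pi_apply n).comp hg))

theorem measurable_roundArm {X : Type*} [MeasurableSpace X] {u : X → ℕ → unitInterval}
    {x : X → ℕ → ℝ} (hu : Measurable u) (hx : Measurable x) (B t : ℕ) :
    Measurable fun y => q.roundArm N B (u y) (x y) t := by
  refine measurable_sampleArm_dist (measurable_seedState ?_ ?_ _)
    ((measurable_pi_apply _).comp hu)
  · exact measurable_pi_lambda _ fun k => (measurable_pi_apply _).comp hu
  · refine measurable_pi_lambda _ fun k => Measurable.div_const ?_ _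
    exact Finset.measurable_sum _ fun r _ => ((measurable_pi_apply _).comp hx).const_sub 1

end Learner

/-- The strategy of a player who keeps her arms for `B` rounds, and chooses them with the learner
`q`, which is restarted after `N` arms. -/
noncomputable def learnerStrategy {K : ℕ} (q : Learner K) (N B T : ℕ) : PlayerStrategy K T where
  act t u x := q.roundArm N B
    -- The padding by `0` of the unseen seeds and losses is never read when `B > 0`, by
    -- `roundArm_congr`.
    (fun s => if hs : s ≤ t.1 then u ⟨⟨s, hs.trans_lt t.2⟩, hs⟩ else 0)
    (fun s => if hs : s < t.1 then x ⟨⟨s, hs.trans t.2⟩, hs⟩ else 0) t.1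
  measurable_act t := by
    refine Learner.measurable_roundArm (measurable_pi_lambda _ fun s => ?_)
      (measurable_pi_lambda _ fun s => ?_) B t.1
    · split_ifs
      · exact (measurable_pi_apply _).comp measurable_fst
      · exact measurable_const
    · split_ifs
      · exact (measurable_pi_apply _).comp measurable_snd
      · exact measurable_const

section Play

variable {m K T : ℕ} (σ : Fin m → PlayerStrategy K T) (ℓ : Fin T → Fin K → ℝ)

theorem measurable_play (t : Fin T) (i : Fin m) : Measurable fun ω => play σ ℓ ω t i := by
  induction t using WellFoundedLT.induction generalizing i with
  | ind t ih =>
    have h1 : ∀ s : Set.Iio t, Measurable fun ω => sufferedLoss (ℓ s.1)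
        (fun j => play σ ℓ ω s.1 j) i := fun s => by
      have h2 : Measurable fun ω => fun j => play σ ℓ ω s.1 j :=
        measurable_pi_lambda _ fun j => ih s.1 s.2 j
      have h3 : Measurable fun a : Fin m → Fin K => sufferedLoss (ℓ s.1) a i :=
        Measurable.of_discrete
      exact h3.comp h2
    have h4 : Measurable fun ω : Fin T → Fin m → unitInterval =>
        ((fun s : Set.Iic t => ω s.1 i), (fun s : Set.Iio t => sufferedLoss (ℓ s.1)
          (fun j => play σ ℓ ω s.1 j) i)) :=
      (measurable_pi_lambda _ fun s => by fun_prop).prodMk (measurable_pi_lambda _ h1)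
    have h5 := ((σ i).measurable_act t).comp h4
    simp only [Function.comp_def] at h5
    have h6 : (fun ω => play σ ℓ ω t i) = fun ω => (σ i).act t (fun s => ω s.1 i)
        (fun s => sufferedLoss (ℓ s.1) (fun j => play σ ℓ ω s.1 j) i) := by
      funext ω
      rw [play]
    rw [h6]
    exact h5

/-- The seeds of the other players in round `t` do not matter: this makes simultaneous choices
independent given the past. -/
theorem play_congr {ω ω' : Fin T → Fin m → unitInterval} (t : Fin T) (i : Fin m)
    (hs : ∀ s < t, ω s = ω' s) (ht : ω t i = ω' t i) : play σ ℓ ω t i = play σ ℓ ω' t i := by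
  induction t using WellFoundedLT.induction generalizing i with
  | ind t ih =>
    rw [play, play]
    congr 1
    · funext s
      rcases (show s.1 ≤ t from s.2).lt_or_eq with h | h
      · rw [hs _ h]
      · rw [h, ht]
    · funext s
      have hst : s.1 < t := s.2
      congr 1
      funext j
      exact ih s.1 hst j (fun r hr => hs r (hr.trans hst)) (by rw [hs _ hst])

end Play

section PlayPath

variable {m K T : ℕ}

/-- Extension of a path to all times; the players return to their home arms at the end. -/
def extendPath (h : m ≤ K) (a : Fin T → Fin m → Fin K) (t : ℕ) (i : Fin m) : Fin K :=
  if ht : t < T then a ⟨t, ht⟩ i else homeArm h i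

/-- Extension of the losses to all times, by `1`. -/
def extendLoss (ℓ : Fin T → Fin K → ℝ) (t : ℕ) (a : Fin K) : ℝ :=
  if ht : t < T then ℓ ⟨t, ht⟩ a else 1

/-- The strategies of the players. -/
noncomputable def strategy (h : m ≤ K) (N T : ℕ) (i : Fin m) : PlayerStrategy K T :=
  learnerStrategy (learner h N i) N (blockLen m N i) T

variable (h : m ≤ K) (N : ℕ) (ℓ : Fin T → Fin K → ℝ)

/-- The path of the action profiles, when the players use `strategy`. -/
noncomputable def playPath (ω : Fin T → Fin m → unitInterval) : ℕ → Fin m → Fin K :=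
  extendPath h (play (strategy h N T) ℓ ω)

variable {N}

theorem playPath_eq_roundArm (hN : 0 < N) (ω : Fin T → Fin m → unitInterval) {t : ℕ} (ht : t < T)
    (i : Fin m) : playPath h N ℓ ω t i = (learner h N i).roundArm N (blockLen m N i)
      (fun s => if hs : s < T then ω ⟨s, hs⟩ i else 0)
      (fun s => sufferedLoss (extendLoss ℓ s) (playPath h N ℓ ω s) i) t := by
  rw [playPath, extendPath, dif_pos ht, play]
  simp only [strategy, learnerStrategy]
  refine Learner.roundArm_congr (blockLen_pos hN i) (fun s hs => ?_) (fun s hs => ?_)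
  · rw [dif_pos hs, dif_pos (hs.trans_lt ht)]
  · simp only [dif_pos hs]
    congr 1
    · funext a; simp [extendLoss, hs.trans ht]
    · funext j; simp [extendPath, hs.trans ht]

theorem playPath_eq_sampleArm (hN : 0 < N) (ω : Fin T → Fin m → unitInterval) (i : Fin m) {k : ℕ}
    (hk : k * blockLen m N i < T) : playPath h N ℓ ω (k * blockLen m N i) i =
      sampleArm (learner h N i).home ((learner h N i).dist
        (pathState h N (extendLoss ℓ) i k (playPath h N ℓ ω))) (ω ⟨k * blockLen m N i, hk⟩ i) := by
  have hB := blockLen_pos hN i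
  have key : ∀ n, n * blockLen m N i < T → playPath h N ℓ ω (n * blockLen m N i) i =
      sampleArm (learner h N i).home ((learner h N i).dist ((learner h N i).seedState N
        (fun k => if hs : k * blockLen m N i < T then ω ⟨k * blockLen m N i, hs⟩ i else 0)
        (avgGain N (extendLoss ℓ) (playPath h N ℓ ω) i) n))
        (if hs : n * blockLen m N i < T then ω ⟨n * blockLen m N i, hs⟩ i else 0) := by
    intro n hn
    rw [playPath_eq_roundArm h ℓ hN ω hn i, Learner.roundArm, Nat.mul_div_cancel _ hB]
    rfl
  rw [key k hk, dif_pos hk, Learner.seedState_eq_state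
    (A := fun k => playPath h N ℓ ω (k * blockLen m N i) i)]
  · rfl
  · intro n hn
    exact key n (lt_of_le_of_lt (Nat.mul_le_mul_right _ hn.le) hk)

theorem playPath_congr {ω ω' : Fin T → Fin m → unitInterval} (t : ℕ) (i : Fin m)
    (hs : ∀ s : Fin T, s.1 < t → ω s = ω' s)
    (ht : ∀ hT : t < T, ω ⟨t, hT⟩ i = ω' ⟨t, hT⟩ i) :
    playPath h N ℓ ω t i = playPath h N ℓ ω' t i := by
  unfold playPath extendPath
  split_ifs with hT
  · exact play_congr _ ℓ ⟨t, hT⟩ i (fun s hst => hs s hst) (ht hT)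
  · rfl

/-- Every function of the path is integrable, because only finitely many paths occur. For `sample`,
the single seed with which `i` draws her arm is resampled. This preserves the law and leaves the
past and the simultaneous arms of the others unchanged, so that only the first argument of `f` is
random. -/
theorem isLearnerProcess_playPath (hq : ∀ i, (learner h N i).Valid) (hN : 0 < N) :
    IsLearnerProcess (Measure.pi fun _ : Fin T => Measure.pi fun _ : Fin m =>
      (volume : Measure unitInterval)) h N T (extendLoss ℓ) (playPath h N ℓ) := by
  have hmeas : Measurable fun ω => play (strategy h N T) ℓ ω :=
    measurable_pi_lambda _ fun t => measurable_pi_lambda _ fun i => measurable_play _ ℓ t i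
  have hf : ∀ f : (ℕ → Fin m → Fin K) → ℝ, Measurable fun ω => f (playPath h N ℓ ω) := by
    intro f
    have h1 : Measurable fun a : Fin T → Fin m → Fin K => f (extendPath h a) :=
      Measurable.of_discrete
    exact h1.comp hmeas
  refine ⟨fun ω t i => ?_, fun ω t i ht => ?_, fun f => ?_, fun i k hk f hinv => ?_⟩
  · by_cases ht : t < T
    · rw [playPath_eq_roundArm h ℓ hN ω ht]
      exact Learner.sampleArm_mem (hq i) _ _
    · rw [playPath, extendPath, dif_neg ht]
      exact homeArm_mem h i
  · rw [playPath_eq_roundArm h ℓ hN ω ht,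
      playPath_eq_roundArm h ℓ hN ω ((Nat.div_mul_le_self _ _).trans_lt ht),
      Learner.roundArm_mul (blockLen_pos hN i)]
  · obtain ⟨C, hC⟩ := (Set.finite_range
      fun a : Fin T → Fin m → Fin K => ‖f (extendPath h a)‖).bddAbove
    refine Integrable.of_bound (hf f).aestronglyMeasurable C (ae_of_all _ fun ω => ?_)
    exact hC ⟨play (strategy h N T) ℓ ω, rfl⟩
  · set P := Measure.pi fun _ : Fin T => Measure.pi fun _ : Fin m =>
      (volume : Measure unitInterval) with hP
    set t : Fin T := ⟨k * blockLen m N i, hk⟩ with ht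
    have hmp := measurePreserving_update_update (volume : Measure unitInterval) t i
    set Φ := fun p : (Fin T → Fin m → unitInterval) × unitInterval =>
      Function.update p.1 t (Function.update (p.1 t) i p.2) with hΦ
    set F := fun ω => f (playPath h N ℓ ω (k * blockLen m N i) i) (playPath h N ℓ ω) with hF
    have hFm : Measurable F := hf fun β => f (β (k * blockLen m N i) i) β
    obtain ⟨C, hC⟩ := (Set.finite_range fun a : Fin T → Fin m → Fin K =>
      ‖f (extendPath h a (k * blockLen m N i) i) (extendPath h a)‖).bddAbove
    have hFi : Integrable (fun p => F (Φ p)) (P.prod volume) :=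
      Integrable.of_bound (hFm.comp hmp.measurable).aestronglyMeasurable C
        (ae_of_all _ fun p => hC ⟨play (strategy h N T) ℓ (Φ p), rfl⟩)
    have h1 : ∫ ω, F ω ∂P = ∫ p, F (Φ p) ∂(P.prod volume) := by
      rw [← integral_map hmp.measurable.aemeasurable hFm.aestronglyMeasurable, hmp.map_eq]
    rw [h1, integral_prod _ hFi]
    refine integral_congr_ae (ae_of_all _ fun ω => ?_)
    have hpre : ∀ u, ∀ s < k * blockLen m N i,
        playPath h N ℓ (Φ (ω, u)) s = playPath h N ℓ ω s := by
      intro u s hs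
      funext j
      have hne : ∀ r : Fin T, r.1 < k * blockLen m N i → Φ (ω, u) r = ω r := fun r hr => by
        simp only [hΦ]
        rw [Function.update_of_ne]
        intro he
        rw [he] at hr
        exact lt_irrefl _ hr
      exact playPath_congr h ℓ s j (fun r hr => hne r (hr.trans hs))
        fun hT => by rw [hne ⟨s, hT⟩ hs]
    have hoth : ∀ u, ∀ j ≠ i, playPath h N ℓ (Φ (ω, u)) (k * blockLen m N i) j =
        playPath h N ℓ ω (k * blockLen m N i) j := by
      intro u j hj
      refine playPath_congr h ℓ _ j (fun r hr => ?_) fun hT => ?_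
      · simp only [hΦ]
        rw [Function.update_of_ne]
        intro he
        rw [he] at hr
        exact lt_irrefl _ hr
      · change Φ (ω, u) t j = ω t j
        simp [hΦ, hj]
    have hown : ∀ u, F (Φ (ω, u)) = f (sampleArm (learner h N i).home ((learner h N i).dist
        (pathState h N (extendLoss ℓ) i k (playPath h N ℓ ω))) u) (playPath h N ℓ ω) := by
      intro u
      simp only [hF]
      rw [hinv _ _ (playPath h N ℓ ω) (hpre u) (hoth u), playPath_eq_sampleArm h ℓ hN _ i hk,
        pathState_congr h hN i k (hpre u)]
      congr 2
      change Φ (ω, u) t i = u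
      simp [hΦ]
    simp_rw [hown]
    exact integral_sampleArm _ (Learner.dist_nonneg _ (hq i)) (Learner.sum_dist _ (hq i))
      fun b => f b (playPath h N ℓ ω)

end PlayPath

end MultiBandit

/-! ### Choice of `N` and conclusion -/

namespace MultiBandit

variable {m K T : ℕ}

theorem regretAgainst_le_mul (σ : Fin m → PlayerStrategy K T) {ℓ : Fin T → Fin K → ℝ}
    (hℓ : ∀ t a, ℓ t a ∈ Set.Icc (0 : ℝ) 1) (S : Finset (Fin K)) :
    regretAgainst σ ℓ S ≤ m * T := by
  have hle : ∀ ω, ∑ t : Fin T, (∑ i : Fin m, sufferedLoss (ℓ t) (play σ ℓ ω t) i -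
      ∑ a ∈ S, ℓ t a) ≤ (m : ℝ) * T := by
    intro ω
    refine (Finset.sum_le_card_nsmul _ _ (m : ℝ) fun t _ => ?_).trans_eq (by simp [mul_comm])
    have h1 : ∑ i : Fin m, sufferedLoss (ℓ t) (play σ ℓ ω t) i ≤ m :=
      (Finset.sum_le_card_nsmul _ _ (1 : ℝ) fun i _ => sufferedLoss_le_one (hℓ t) i).trans_eq
        (by simp)
    linarith [Finset.sum_nonneg fun a (_ : a ∈ S) => (hℓ t a).1]
  unfold regretAgainst
  -- Without integrability the integral is `0` by convention, so no measurability is needed here.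
  by_cases hi : Integrable (fun ω => ∑ t : Fin T, (∑ i : Fin m,
      sufferedLoss (ℓ t) (play σ ℓ ω t) i - ∑ a ∈ S, ℓ t a))
      (Measure.pi fun _ : Fin T => Measure.pi fun _ : Fin m => (volume : Measure unitInterval))
  · exact (integral_mono hi (integrable_const _) hle).trans_eq (by simp)
  · rw [integral_undef hi]; positivity

theorem regretAgainst_strategy_le (h : m ≤ K) {N : ℕ} (hN0 : 0 < N) (hN : 4 * K ^ 2 ≤ N)
    (hT : T ≤ N ^ m) {ℓ : Fin T → Fin K → ℝ} (hℓ : ∀ t a, ℓ t a ∈ Set.Icc (0 : ℝ) 1)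
    {S : Finset (Fin K)} (hS : S.card = m) :
    regretAgainst (strategy h N T) ℓ S ≤
      m * ((N : ℝ) ^ m * (K * (9 + Real.log (N + K)) / √N)) := by
  have hl : ∀ t b, extendLoss ℓ t b ∈ Set.Icc (0 : ℝ) 1 := by
    intro t b
    unfold extendLoss
    split_ifs
    · exact hℓ _ _
    · exact ⟨zero_le_one, le_rfl⟩
  have hlT : ∀ t b, T ≤ t → extendLoss ℓ t b = 1 := fun t b ht => by
    rw [extendLoss, dif_neg (not_lt.2 ht)]
  refine le_of_eq_of_le ?_ ((isLearnerProcess_playPath h ℓ (learner_valid h hN)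
    hN0).integral_regret_le hN hl hlT hT hS)
  unfold regretAgainst
  congr 1
  funext ω
  rw [Finset.sum_range]
  refine Finset.sum_congr rfl fun t _ => ?_
  have h1 : playPath h N ℓ ω t = play (strategy h N T) ℓ ω t := by
    funext i; simp [playPath, extendPath]
  have h2 : extendLoss ℓ t = ℓ t := by
    funext a; simp [extendLoss]
  rw [h1, h2]

/-- The value of the bound for `regretAgainst_strategy_le` with `T ^ (1 / m)` arms per block. -/
theorem regret_bound_le (hm : 1 ≤ m) (h : m ≤ K) (hT : 1 ≤ T) {y : ℝ} (hy : 1 ≤ y)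
    (hyT : (y ^ 2) ^ m = T) (hyK : 4 * (K : ℝ) ^ 2 ≤ y ^ 2) :
    (m : ℝ) * ((⌈y ^ 2⌉₊ : ℝ) ^ m * (K * (9 + Real.log (⌈y ^ 2⌉₊ + K)) / √⌈y ^ 2⌉₊)) ≤
      33 * (m * K * (T / y)) * (1 + Real.log (K * T)) := by
  have hK1 : (1 : ℝ) ≤ K := by exact_mod_cast hm.trans h
  have hT1 : (1 : ℝ) ≤ T := by exact_mod_cast hT
  have hmK : (m : ℝ) ≤ K := by exact_mod_cast h
  have hy0 : 0 < y := by linarith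
  have hx : 0 < y ^ 2 := by positivity
  set N : ℝ := (⌈y ^ 2⌉₊ : ℝ) with hN
  have hN1 : y ^ 2 ≤ N := Nat.le_ceil _
  have hN2 : N ≤ y ^ 2 + 1 := (Nat.ceil_lt_add_one hx.le).le
  have hNpow : N ^ m ≤ 3 * T := by
    have h1 : N ≤ y ^ 2 * (1 + 1 / y ^ 2) := by
      rw [mul_add, mul_one, mul_one_div_cancel hx.ne']; exact hN2
    have h2 : 1 + 1 / y ^ 2 ≤ Real.exp (1 / y ^ 2) := by
      linarith [Real.add_one_le_exp (1 / y ^ 2)]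
    -- Rounding `y ^ 2` up costs only a constant factor even after the `m`-th power, because `m ≤ K
    -- ≤ 4 * K ^ 2 ≤ y ^ 2`.
    have h3 : (m : ℝ) * (1 / y ^ 2) ≤ 1 := by
      rw [mul_one_div, div_le_one hx]; nlinarith
    have h4 : (1 + 1 / y ^ 2) ^ m ≤ 3 := by
      calc (1 + 1 / y ^ 2) ^ m ≤ Real.exp (1 / y ^ 2) ^ m := by gcongr
        _ = Real.exp (m * (1 / y ^ 2)) := by rw [← Real.exp_nat_mul]
        _ ≤ Real.exp 1 := Real.exp_le_exp.2 h3
        _ ≤ 3 := by linarith [Real.exp_one_lt_d9]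
    calc N ^ m ≤ (y ^ 2 * (1 + 1 / y ^ 2)) ^ m := by gcongr
      _ = T * (1 + 1 / y ^ 2) ^ m := by rw [mul_pow, hyT]
      _ ≤ T * 3 := by gcongr
      _ = 3 * T := mul_comm _ _
  have hsqrt : y ≤ √N := Real.le_sqrt_of_sq_le hN1
  have hyT' : y ^ 2 ≤ T := by
    rw [← hyT]
    exact le_self_pow₀ (by nlinarith) (by omega)
  have hKT : 1 ≤ (K : ℝ) * T := one_le_mul_of_one_le_of_one_le hK1 hT1
  have hlog0 : 0 ≤ Real.log (K * T) := Real.log_nonneg hKT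
  have hlog : Real.log (N + K) ≤ 2 + Real.log (K * T) := by
    have h1 : N + K ≤ 3 * (K * T) := by nlinarith
    have h2 : Real.log 3 ≤ 2 := by
      rw [Real.log_le_iff_le_exp (by norm_num)]
      linarith [Real.add_one_le_exp (2 : ℝ)]
    calc Real.log (N + K) ≤ Real.log (3 * (K * T)) := Real.log_le_log (by positivity) h1
      _ = Real.log 3 + Real.log (K * T) := Real.log_mul (by norm_num) (by positivity)
      _ ≤ _ := by linarith
  have hlog1 : 0 ≤ Real.log (N + K) := Real.log_nonneg (by nlinarith)
  calc (m : ℝ) * (N ^ m * (K * (9 + Real.log (N + K)) / √N)) ≤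
        m * (3 * T * (K * (9 + (2 + Real.log (K * T))) / y)) := by gcongr
    _ ≤ m * (3 * T * (K * (11 * (1 + Real.log (K * T))) / y)) := by
        gcongr
        linarith
    _ = _ := by ring

end MultiBandit

theorem mainTheorem4 :
    ∃ (C : ℝ) (p : ℕ), 0 < C ∧ ∀ m K T : ℕ, 1 ≤ m → m ≤ K → 1 ≤ T →
      ∃ σ : Fin m → MultiBandit.PlayerStrategy K T,
        ∀ ℓ : Fin T → Fin K → ℝ, (∀ t a, ℓ t a ∈ Set.Icc (0 : ℝ) 1) →
          MultiBandit.regret σ ℓ ≤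
            C * ((m : ℝ) * (K : ℝ) ^ (3 / 2 : ℝ) * (T : ℝ) ^ (1 - 1 / (2 * (m : ℝ)))) *
              (1 + Real.log ((K : ℝ) * (T : ℝ))) ^ p := by
  -- The constant is `3 * 11`: `N ^ m ≤ 3 * T`, and `9 + log (N + K) ≤ 11 * (1 + log (K * T))`.
  refine ⟨33, 1, by norm_num, fun m K T hm h hT => ?_⟩
  have hK1 : (1 : ℝ) ≤ K := by exact_mod_cast hm.trans h
  have hT1 : (1 : ℝ) ≤ T := by exact_mod_cast hT
  have hm0 : (0 : ℝ) < m := by exact_mod_cast hm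
  set y : ℝ := (T : ℝ) ^ (1 / (2 * (m : ℝ))) with hy
  have hy1 : 1 ≤ y := Real.one_le_rpow hT1 (by positivity)
  have hy0 : 0 < y := by linarith
  have hyT : (y ^ 2) ^ m = T := by
    rw [← pow_mul, hy, ← Real.rpow_natCast, ← Real.rpow_mul (by linarith)]
    push_cast
    rw [one_div_mul_cancel (by positivity), Real.rpow_one]
  have hpow : (T : ℝ) ^ (1 - 1 / (2 * (m : ℝ))) = T / y := by
    rw [Real.rpow_sub (by linarith), Real.rpow_one]
  -- The argument yields the factor `K`, which is weakened to `K ^ (3 / 2)` only here.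
  have hK32 : (K : ℝ) ≤ (K : ℝ) ^ (3 / 2 : ℝ) := by
    nth_rewrite 1 [← Real.rpow_one (K : ℝ)]
    exact Real.rpow_le_rpow_of_exponent_le hK1 (by norm_num)
  have hlog0 : 0 ≤ Real.log (K * T) :=
    Real.log_nonneg (one_le_mul_of_one_le_of_one_le hK1 hT1)
  obtain ⟨S₀, -, hS₀⟩ := Finset.exists_subset_card_eq
    (s := (Finset.univ : Finset (Fin K))) (n := m) (by simpa using h)
  have hne : Nonempty {S : Finset (Fin K) // S.card = m} := ⟨⟨S₀, hS₀⟩⟩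
  refine ⟨MultiBandit.strategy h ⌈y ^ 2⌉₊ T, fun ℓ hℓ => ?_⟩
  rw [hpow, pow_one]
  refine ciSup_le fun S => ?_
  by_cases hyK : 4 * (K : ℝ) ^ 2 ≤ y ^ 2
  · have hN0 : 0 < ⌈y ^ 2⌉₊ := Nat.ceil_pos.2 (by positivity)
    have hN : 4 * K ^ 2 ≤ ⌈y ^ 2⌉₊ := by
      have := hyK.trans (Nat.le_ceil (y ^ 2))
      exact_mod_cast this
    have hTN : T ≤ ⌈y ^ 2⌉₊ ^ m := by
      have h1 : (T : ℝ) ≤ (⌈y ^ 2⌉₊ : ℝ) ^ m := by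
        rw [← hyT]
        gcongr
        exact Nat.le_ceil _
      exact_mod_cast h1
    refine (MultiBandit.regretAgainst_strategy_le h hN0 hN hTN hℓ S.2).trans
      ((MultiBandit.regret_bound_le hm h hT hy1 hyT hyK).trans ?_)
    gcongr
  -- For so short a horizon, `m * T ≤ 2 * m * K * (T / y)`, and any strategy meets the bound.
  · have hy2 : y ≤ 2 * K := by nlinarith
    refine (MultiBandit.regretAgainst_le_mul _ hℓ S.1).trans ?_
    have h1 : (m : ℝ) * T ≤ 33 * (m * K * (T / y)) := by
      have h2 : (T : ℝ) = T / y * y := by field_simp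
      have h3 : 0 ≤ T / y := by positivity
      have h4 : T / y * y ≤ T / y * (33 * K) := by gcongr; linarith
      calc (m : ℝ) * T = m * (T / y * y) := by rw [← h2]
        _ ≤ m * (T / y * (33 * K)) := by gcongr
        _ = _ := by ring
    calc (m : ℝ) * T ≤ 33 * (m * K * (T / y)) * 1 := by rw [mul_one]; exact h1
      _ ≤ _ := by gcongr; linarith
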